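/- Let $I=[a,b]$ with $a<b$, let $n,k\in\mathbb N$, let $V=\mathbb R^{n\times k}$, let $\lambda_1,\dots,\lambda_k>0$, $L=\mathrm{diag}(\lambda_1,\dots,\lambda_k)$ and $\langle A,B\rangle_L=\mathrm{tr}(LA^TB)$ on $V$. Let $\mathfrak o(n)$ be the antisymmetric $n\times n$ matrices with $\langle X,Y\rangle_{\mathfrak o(n)}=\mathrm{tr}(X^TY)$. For $B\in V$ let $B^\flat=\langle B,\cdot\rangle_L\in V^*$, and for $A\in V$, $\beta\in V^*$ let $A\diamond\beta\in\mathfrak o(n)^*$ be given by $\langle A\diamond\beta,\sigma\rangle=\beta(\sigma A)$ for all $\sigma\in\mathfrak o(n)$. Identify $\mathfrak o(n)^*$ with $\mathfrak o(n)$ through the inner product, $X\leftrightarrow\langle X,\cdot\rangle_{\mathfrak o(n)}$. For a $C^k$ curve $c:I\to\mathbb R^n$ let $j^{1,k}_sc\in V$ be the matrix with columns $c'(s),\dots,c^{(k)}(s)$. Let $H^1(I,O(n))$ be the set of absolutely continuous curves $g:I\to O(n)\subset\mathbb R^{n\times n}$ with $g'\in L^2$. **(1)** Let $c_1,c_2:I\to\mathbb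 R^n$ be of class $C^k$. The energy $$E[g;c_1,c_2]=\frac12\int_I\Big(\|g(s)\,j^{1,k}_sc_1-j^{1,k}_sc_2\|_L^2+\|g(s)^{-1}g'(s)\|_{\mathfrak o(n)}^2\Big)\,ds$$ is well defined (the integrand is integrable) for every $g\in H^1(I,O(n))$ and attains its global minimum on $H^1(I,O(n))$. Every minimizer $g\in H^1(I,O(n))$ is of class $C^2$ on $I$, and $\Omega(s)=g(s)^{-1}g'(s)$ satisfies, in the classical sense at every $s\in I$, the variational equations $$\Omega'(s)=\big(g(s)^{-1}j^{1,k}_sc_2\big)\diamond\big(j^{1,k}_sc_1\big)^\flat,\qquad \Omega(a)=\Omega(b)=0 .$$ **(2)** The same holds for a general potential. Let $U:I\times O(n)\to\mathbb R$ be continuous and differentiable in the second variable, with continuous derivative $D_2U$ on $I\times O(n)$. Then $$E(g)=\int_I\Big(U(s,g(s))+\frac12\|g(s)^{-1}g'(s)\|_{\mathfrak o(n)}^2\Big)\,ds$$ is well defined on $H^1(I,O(n))$ and attains its global minimum there. Every minimizer $g$ is of class $C^2$ on $I$, and $\Omega=g^{-1}g'$ satisfies, at every $s\in I$, $\langle\Omega'(s),\sigma\rangle_{\mathfrak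 o(n)}=D_2U(s,g(s))\,(g(s)\sigma)$ for all $\sigma\in\mathfrak o(n)$, with $\Omega(a)=\Omega(b)=0$. -/

import Mathlib

open Set MeasureTheory
open scoped Matrix Matrix.Norms.Elementwise

noncomputable section

namespace CurveRegistration

/-- The weighted inner product `⟨A, B⟩_L = tr (L Aᵀ B)` on `n × k` matrices, where
`L = diag (w₁, …, w_k)`. -/
def innerL {n k : ℕ} (w : Fin k → ℝ) (A B : Matrix (Fin n) (Fin k) ℝ) : ℝ :=
  (Matrix.diagonal w * Aᵀ * B).trace

/-- The flat operation `♭ : V → V*` induced by `⟨·, ·⟩_L`. -/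
def flat {n k : ℕ} (w : Fin k → ℝ) (B : Matrix (Fin n) (Fin k) ℝ) :
    Module.Dual ℝ (Matrix (Fin n) (Fin k) ℝ) where
  toFun A := innerL w B A
  map_add' A A' := by simp [innerL, Matrix.mul_add]
  map_smul' r A := by simp [innerL]

/-- The inner product `⟨X, Y⟩ = tr (Xᵀ Y)`, which on antisymmetric matrices is the inner product
of the Lie algebra `𝔬(n)`. -/
def innerO {n : ℕ} (X Y : Matrix (Fin n) (Fin n) ℝ) : ℝ :=
  (Xᵀ * Y).trace

/-- The identification `𝔬(n) ≅ 𝔬(n)*`, `X ↦ ⟨X, ·⟩`, given by the inner product of `𝔬(n)`. -/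
def dualO {n : ℕ} (X : LieAlgebra.Orthogonal.so (Fin n) ℝ) :
    Module.Dual ℝ (LieAlgebra.Orthogonal.so (Fin n) ℝ) where
  toFun Y := innerO (X : Matrix (Fin n) (Fin n) ℝ) Y
  map_add' Y Y' := by simp [innerO, Matrix.mul_add]
  map_smul' r Y := by simp [innerO]

/-- The diamond operator `⋄ : V × V* → 𝔬(n)*`, `⟨A ⋄ β, σ⟩ = ⟨β, σ A⟩`. -/
def diamond {n k : ℕ} (A : Matrix (Fin n) (Fin k) ℝ)
    (β : Module.Dual ℝ (Matrix (Fin n) (Fin k) ℝ)) :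
    Module.Dual ℝ (LieAlgebra.Orthogonal.so (Fin n) ℝ) where
  toFun σ := β ((σ : Matrix (Fin n) (Fin n) ℝ) * A)
  map_add' σ τ := by simp [Matrix.add_mul]
  map_smul' r σ := by simp

/-- The `(1, k)`-jet at `s` of a curve `c : [a, b] → ℝⁿ`: the `n × k` matrix with columns
`c'(s), …, c⁽ᵏ⁾(s)`. -/
def jet {n : ℕ} (a b : ℝ) (k : ℕ) (c : ℝ → EuclideanSpace ℝ (Fin n)) (s : ℝ) :
    Matrix (Fin n) (Fin k) ℝ :=
  Matrix.of fun j i => iteratedDerivWithin ((i : ℕ) + 1) c (Icc a b) s j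

/-- The space `H¹([a, b], O(n))`: absolutely continuous curves in `O(n)` whose derivative is
square integrable. Only the values of a curve on `[a, b]` matter. -/
def H1 (a b : ℝ) (n : ℕ) : Set (ℝ → Matrix (Fin n) (Fin n) ℝ) :=
  {g | (∀ s ∈ Icc a b, g s ∈ Matrix.orthogonalGroup (Fin n) ℝ) ∧
    AbsolutelyContinuousOnInterval g a b ∧
    MemLp (derivWithin g (Icc a b)) 2 (volume.restrict (Icc a b))}

/-- The body velocity `Ω(s) = g(s)⁻¹ g'(s)` of a curve `g` on `[a, b]`. -/
def bodyVel {n : ℕ} (a b : ℝ) (g : ℝ → Matrix (Fin n) (Fin n) ℝ) (s : ℝ) :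
    Matrix (Fin n) (Fin n) ℝ :=
  (g s)⁻¹ * derivWithin g (Icc a b) s

/-- The integrand of the curve registration energy. -/
def energyDensity {n k : ℕ} (a b : ℝ) (w : Fin k → ℝ) (c₁ c₂ : ℝ → EuclideanSpace ℝ (Fin n))
    (g : ℝ → Matrix (Fin n) (Fin n) ℝ) (s : ℝ) : ℝ :=
  innerL w (g s * jet a b k c₁ s - jet a b k c₂ s) (g s * jet a b k c₁ s - jet a b k c₂ s)
    + innerO (bodyVel a b g s) (bodyVel a b g s)

/-- The curve registration energy
`E[g; c₁, c₂] = ½ ∫ (‖g j^{1,k} c₁ - j^{1,k} c₂‖_L² + ‖g⁻¹ g'‖²) ds`. -/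
def energy {n k : ℕ} (a b : ℝ) (w : Fin k → ℝ) (c₁ c₂ : ℝ → EuclideanSpace ℝ (Fin n))
    (g : ℝ → Matrix (Fin n) (Fin n) ℝ) : ℝ :=
  (1 / 2) * ∫ s in a..b, energyDensity a b w c₁ c₂ g s

/-- The integrand of the energy with a general potential `U(s, g)`. -/
def potEnergyDensity {n : ℕ} (a b : ℝ) (U : ℝ × Matrix (Fin n) (Fin n) ℝ → ℝ)
    (g : ℝ → Matrix (Fin n) (Fin n) ℝ) (s : ℝ) : ℝ :=
  U (s, g s) + (1 / 2) * innerO (bodyVel a b g s) (bodyVel a b g s)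

/-- The energy `E(g) = ∫ (U(s, g(s)) + ½ ‖g⁻¹ g'‖²) ds` with a general potential `U`. -/
def potEnergy {n : ℕ} (a b : ℝ) (U : ℝ × Matrix (Fin n) (Fin n) ℝ → ℝ)
    (g : ℝ → Matrix (Fin n) (Fin n) ℝ) : ℝ :=
  ∫ s in a..b, potEnergyDensity a b U g s

/-- The functional `σ ↦ D (g σ)` on `𝔬(n)`, for a linear functional `D` on matrices: the
restriction of `D` to the tangent space `T_g O(n) = g 𝔬(n)`, left translated to the identity. -/
def leftTranslate {n : ℕ} (D : Matrix (Fin n) (Fin n) ℝ →L[ℝ] ℝ)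
    (g : Matrix (Fin n) (Fin n) ℝ) :
    Module.Dual ℝ (LieAlgebra.Orthogonal.so (Fin n) ℝ) where
  toFun σ := D (g * (σ : Matrix (Fin n) (Fin n) ℝ))
  map_add' σ τ := by simp [Matrix.mul_add]
  map_smul' r σ := by simp

/-- `g` solves, in the classical sense on `[a, b]`, the equation `Ω' = F` in `𝔬(n) ≅ 𝔬(n)*`, where
`Ω = g⁻¹ g'`, with boundary conditions `Ω(a) = Ω(b) = 0`. -/
structure IsSolution {n : ℕ} (a b : ℝ)
    (F : ℝ → Module.Dual ℝ (LieAlgebra.Orthogonal.so (Fin n) ℝ))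
    (g : ℝ → Matrix (Fin n) (Fin n) ℝ) : Prop where
  differentiableOn : DifferentiableOn ℝ g (Icc a b)
  equation : ∀ s ∈ Icc a b, ∃ Ω' : LieAlgebra.Orthogonal.so (Fin n) ℝ,
    HasDerivWithinAt (bodyVel a b g) (Ω' : Matrix (Fin n) (Fin n) ℝ) (Icc a b) s ∧ dualO Ω' = F s
  left_boundary : bodyVel a b g a = 0
  right_boundary : bodyVel a b g b = 0

end CurveRegistration

end

/-!
The minimum is attained by the direct method, in a form that needs no weak compactness. Left
translation in `O(n)` is an isometry, so `‖g⁻¹ g'‖² = ‖g'‖²` is a sum of squares of derivatives of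
the entries. For a real function `f`, the number `∫ |f'|²` equals the supremum `dirichletEnergy` of
`∑ (f yᵢ - f xᵢ)² / |yᵢ - xᵢ|` over finite families of non-overlapping intervals
(`dirichletEnergy_eq_lintegral`: Cauchy–Schwarz in one direction, Fatou's lemma for difference
quotients over uniform partitions in the other), and a function for which the supremum is finite is
automatically absolutely continuous with square integrable derivative. A supremum of this kind is
lower semicontinuous for pointwise convergence, and a bound on it is a uniform Hölder condition of
exponent `1 / 2`. Hence its sublevel sets among the curves in `O(n)` are compact for uniform
convergence by the Arzelà–Ascoli theorem (`isCompact_energySublevel`). The potential part of the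
energy is continuous for uniform convergence, and a lower semicontinuous function attains its
minimum on a compact set (`exists_isMinOn_potEnergy`).

For the variational equation, a minimizer `g` is compared with `g exp (ε φ σ)`, where `σ` is a
fixed antisymmetric matrix and `φ` a `C¹` function. As `exp (ε φ σ)` commutes with `σ`, the body
velocity of this curve is conjugate to `Ω + ε φ' σ`, so its kinetic energy is a polynomial of degree
two in `ε`, and the vanishing of the first variation reads
`∫ (φ D₂U(s, g) (g σ) + φ' ⟨Ω, σ⟩) = 0` (`integral_firstVariation_eq_zero`). Since `φ` is arbitrary
at the end points too, the lemma of du Bois-Reymond shows that `⟨Ω, σ⟩` agrees almost everywhere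
with the primitive of `D₂U(s, g) (g σ)` vanishing at `a`, and that this primitive also vanishes at
`b` (`ae_eq_integral_of_forall_integral_eq_zero`). The matrices `E_ij - E_ji` span `𝔬(n)`, so `Ω`
has a `C¹` representative. Integrating `g' = g Ω` shows that `g` is `C¹` with `Ω` equal to its
representative everywhere, and then that `g` is `C²` (`contDiffOn_and_isSolution_of_isMinOn`).

The curve registration energy is the case `U(s, x) = ½ ‖x j c₁ - j c₂‖_L²`. The derivative of this
potential along `g 𝔬(n)` is the diamond term (`leftTranslate_registrationPotentialDeriv`).
-/

namespace CurveRegistration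

open Filter Topology ENNReal AbsolutelyContinuousOnInterval

variable {n m k : ℕ}

/-! ### The Dirichlet energy without derivatives -/

/-- The Dirichlet energy `∫ₐᵇ |f'|²` of a function, written without derivatives: the supremum of
`∑ (f yᵢ - f xᵢ)² / |yᵢ - xᵢ|` over finite families of non-overlapping intervals in `[a, b]`.
Degenerate intervals contribute `0 / 0 = 0`. -/
noncomputable def dirichletEnergy (a b : ℝ) (f : ℝ → ℝ) : ℝ≥0∞ :=
  ⨆ E ∈ disjWithin a b, ∑ i ∈ Finset.range E.1,
    ENNReal.ofReal ((f (E.2 i).1 - f (E.2 i).2) ^ 2 / dist (E.2 i).1 (E.2 i).2)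

lemma sum_ofReal_le_dirichletEnergy {a b : ℝ} (f : ℝ → ℝ) {E : ℕ × (ℕ → ℝ × ℝ)}
    (hE : E ∈ disjWithin a b) :
    ∑ i ∈ Finset.range E.1,
      ENNReal.ofReal ((f (E.2 i).1 - f (E.2 i).2) ^ 2 / dist (E.2 i).1 (E.2 i).2)
        ≤ dirichletEnergy a b f :=
  le_iSup₂ (f := fun E (_ : E ∈ disjWithin a b) => ∑ i ∈ Finset.range E.1,
    ENNReal.ofReal ((f (E.2 i).1 - f (E.2 i).2) ^ 2 / dist (E.2 i).1 (E.2 i).2)) E hE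

lemma sq_sum_dist_le {a b : ℝ} {f : ℝ → ℝ} (hf : dirichletEnergy a b f ≠ ∞)
    {E : ℕ × (ℕ → ℝ × ℝ)} (hE : E ∈ disjWithin a b) :
    (∑ i ∈ Finset.range E.1, dist (f (E.2 i).1) (f (E.2 i).2)) ^ 2 ≤
      (dirichletEnergy a b f).toReal * ∑ i ∈ Finset.range E.1, dist (E.2 i).1 (E.2 i).2 := by
  have h1 : ∑ i ∈ Finset.range E.1, (f (E.2 i).1 - f (E.2 i).2) ^ 2 / dist (E.2 i).1 (E.2 i).2 ≤
      (dirichletEnergy a b f).toReal := by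
    rw [← ENNReal.ofReal_le_iff_le_toReal hf, ENNReal.ofReal_sum_of_nonneg]
    · exact sum_ofReal_le_dirichletEnergy f hE
    · intro i _
      positivity
  refine le_trans (Finset.sum_sq_le_sum_mul_sum_of_sq_le_mul _
    (f := fun i => (f (E.2 i).1 - f (E.2 i).2) ^ 2 / dist (E.2 i).1 (E.2 i).2)
    (g := fun i => dist (E.2 i).1 (E.2 i).2) ?_ ?_ ?_)
    (mul_le_mul_of_nonneg_right h1 (Finset.sum_nonneg fun _ _ => dist_nonneg))
  · intro i _
    positivity
  · intro i _
    positivity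
  · intro i _
    rcases eq_or_ne (E.2 i).1 (E.2 i).2 with h | h
    · simp [h]
    · rw [div_mul_cancel₀ _ (dist_pos.2 h).ne', Real.dist_eq, sq_abs]

lemma sq_sub_le_dirichletEnergy {a b : ℝ} {f : ℝ → ℝ} (hf : dirichletEnergy a b f ≠ ∞)
    {x y : ℝ} (hx : x ∈ uIcc a b) (hy : y ∈ uIcc a b) :
    (f x - f y) ^ 2 ≤ (dirichletEnergy a b f).toReal * dist x y := by
  have hE : ((1, fun _ => (x, y)) : ℕ × (ℕ → ℝ × ℝ)) ∈ disjWithin a b := by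
    refine ⟨fun i _ => ⟨hx, hy⟩, ?_⟩
    intro i hi j hj hij
    simp at hi hj
    omega
  have := sq_sum_dist_le hf hE
  simpa [Real.dist_eq] using this

/-- Finite Dirichlet energy forces absolute continuity, by the Cauchy–Schwarz inequality. -/
lemma absolutelyContinuousOnInterval_of_dirichletEnergy {a b : ℝ} {f : ℝ → ℝ}
    (hf : dirichletEnergy a b f ≠ ∞) : AbsolutelyContinuousOnInterval f a b := by
  rw [absolutelyContinuousOnInterval_iff]
  intro ε hε
  set C := (dirichletEnergy a b f).toReal with hC
  have hC0 : 0 ≤ C := ENNReal.toReal_nonneg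
  refine ⟨ε ^ 2 / (C + 1), by positivity, fun E hE hlt => ?_⟩
  have h := sq_sum_dist_le hf hE
  rw [← hC] at h
  rw [lt_div_iff₀ (by positivity)] at hlt
  refine lt_of_pow_lt_pow_left₀ 2 hε.le (lt_of_le_of_lt h ?_)
  have : 0 ≤ ∑ i ∈ Finset.range E.1, dist (E.2 i).1 (E.2 i).2 :=
    Finset.sum_nonneg fun _ _ => dist_nonneg
  nlinarith

/-- Difference quotients over intervals shrinking to a point from both sides. -/
lemma tendsto_slope_of_straddle {ι : Type*} {l : Filter ι} {f : ℝ → ℝ} {f' s : ℝ}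
    (hf : HasDerivAt f f' s) {u v : ι → ℝ} (hu : Tendsto u l (𝓝 s)) (hv : Tendsto v l (𝓝 s))
    (hus : ∀ i, u i ≤ s) (hsv : ∀ i, s < v i) :
    Tendsto (fun i => (f (u i) - f (v i)) / (u i - v i)) l (𝓝 f') := by
  rw [Metric.tendsto_nhds]
  intro ε hε
  have h := (hasDerivAt_iff_isLittleO.1 hf).def (half_pos hε)
  filter_upwards [hu.eventually h, hv.eventually h] with i h1 h2
  have huv : 0 < v i - u i := by linarith [hus i, hsv i]
  have hne : u i - v i ≠ 0 := by linarith
  rw [Real.dist_eq, div_sub' hne, abs_div, div_lt_iff₀ (abs_pos.2 hne)]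
  simp only [Real.norm_eq_abs, smul_eq_mul] at h1 h2
  rw [abs_of_nonpos (by linarith [hus i] : u i - s ≤ 0)] at h1
  rw [abs_of_pos (by linarith [hsv i] : 0 < v i - s)] at h2
  rw [abs_of_neg (by linarith : u i - v i < 0)]
  have h3 := abs_sub (f (u i) - f s - (u i - s) * f') (f (v i) - f s - (v i - s) * f')
  have h4 : f (u i) - f s - (u i - s) * f' - (f (v i) - f s - (v i - s) * f')
      = f (u i) - f (v i) - (u i - v i) * f' := by ring
  rw [h4] at h3
  nlinarith

/-- The `i`-th node of the partition of `[a, b]` into `m + 1` intervals of equal length. -/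
noncomputable def node (a b : ℝ) (m i : ℕ) : ℝ := a + i * ((b - a) / (m + 1))

/-- The difference quotient of `f` on the `i`-th interval of a uniform partition. -/
noncomputable def nodeSlope (a b : ℝ) (f : ℝ → ℝ) (m i : ℕ) : ℝ :=
  (f (node a b m i) - f (node a b m (i + 1))) / (node a b m i - node a b m (i + 1))

/-- The index of the interval of a uniform partition that contains `s`. -/
noncomputable def nodeIndex (a b : ℝ) (m : ℕ) (s : ℝ) : ℕ := ⌊(s - a) / ((b - a) / (m + 1))⌋₊

lemma node_succ_sub {a b : ℝ} (m i : ℕ) :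
    node a b m (i + 1) - node a b m i = (b - a) / (m + 1) := by
  simp only [node]; push_cast; ring

lemma node_mem_Icc {a b : ℝ} (hab : a < b) {m i : ℕ} (hi : i ≤ m + 1) :
    node a b m i ∈ Icc a b := by
  have h1 : (0 : ℝ) < (b - a) / (m + 1) := div_pos (by linarith) (by positivity)
  have h2 : ((m : ℝ) + 1) * ((b - a) / (m + 1)) = b - a := by field_simp
  have h3 : (i : ℝ) ≤ m + 1 := by exact_mod_cast hi
  constructor
  · simp only [node]; nlinarith [Nat.cast_nonneg (α := ℝ) i]
  · simp only [node]; nlinarith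

lemma node_mono {a b : ℝ} (hab : a < b) (m : ℕ) : Monotone (node a b m) := by
  intro i j hij
  have h1 : (0 : ℝ) < (b - a) / (m + 1) := div_pos (by linarith) (by positivity)
  have h3 : (i : ℝ) ≤ j := by exact_mod_cast hij
  simp only [node]; nlinarith

lemma mem_Ico_node {a b : ℝ} (hab : a < b) (m : ℕ) {s : ℝ} (hs : a ≤ s) :
    s ∈ Ico (node a b m (nodeIndex a b m s)) (node a b m (nodeIndex a b m s + 1)) := by
  have h1 : (0 : ℝ) < (b - a) / (m + 1) := div_pos (by linarith) (by positivity)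
  have h0 : 0 ≤ (s - a) / ((b - a) / (m + 1)) := div_nonneg (by linarith) h1.le
  have h2 := Nat.floor_le h0
  have h3 := Nat.lt_floor_add_one ((s - a) / ((b - a) / (m + 1)))
  rw [le_div_iff₀ h1] at h2
  rw [div_lt_iff₀ h1] at h3
  constructor
  · simp only [node, nodeIndex]; linarith
  · simp only [node, nodeIndex]; push_cast; linarith

lemma nodeIndex_lt {a b : ℝ} (hab : a < b) (m : ℕ) {s : ℝ} (hs : s ∈ Ico a b) :
    nodeIndex a b m s < m + 1 := by
  have h1 : (0 : ℝ) < (b - a) / (m + 1) := div_pos (by linarith) (by positivity)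
  rw [nodeIndex, Nat.floor_lt (div_nonneg (by linarith [hs.1]) h1.le), div_lt_iff₀ h1]
  push_cast
  have h2 : ((m : ℝ) + 1) * ((b - a) / (m + 1)) = b - a := by field_simp
  rw [h2]; linarith [hs.2]

lemma nodeIndex_eq {a b : ℝ} (hab : a < b) (m i : ℕ) {s : ℝ}
    (hs : s ∈ Ico (node a b m i) (node a b m (i + 1))) : nodeIndex a b m s = i := by
  have h1 : (0 : ℝ) < (b - a) / (m + 1) := div_pos (by linarith) (by positivity)
  have ha : a ≤ node a b m i := by
    simpa [node] using node_mono hab m (Nat.zero_le i)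
  rw [nodeIndex, Nat.floor_eq_iff (div_nonneg (by linarith [hs.1]) h1.le), le_div_iff₀ h1,
    div_lt_iff₀ h1]
  have h2 := hs.1
  have h3 := hs.2
  simp only [node] at h2 h3
  push_cast at h3
  constructor <;> linarith

lemma nodes_mem_disjWithin {a b : ℝ} (hab : a < b) (m : ℕ) :
    ((m + 1, fun i => (node a b m i, node a b m (i + 1))) : ℕ × (ℕ → ℝ × ℝ)) ∈
      disjWithin a b := by
  constructor
  · intro i hi
    have hi' : i < m + 1 := Finset.mem_range.1 hi
    rw [uIcc_of_le hab.le]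
    exact ⟨node_mem_Icc hab hi'.le, node_mem_Icc hab hi'⟩
  · intro i _ j _ hij
    simp only [Function.onFun]
    rw [uIoc_of_le (node_mono hab m (Nat.le_succ i)), uIoc_of_le (node_mono hab m (Nat.le_succ j))]
    exact (node_mono hab m).pairwise_disjoint_on_Ioc_succ hij

lemma lintegral_nodeSlope_Ico {a b : ℝ} (hab : a < b) (f : ℝ → ℝ) (m i : ℕ) :
    ∫⁻ s in Ico (node a b m i) (node a b m (i + 1)),
        ENNReal.ofReal (nodeSlope a b f m (nodeIndex a b m s) ^ 2) =
      ENNReal.ofReal ((f (node a b m i) - f (node a b m (i + 1))) ^ 2 /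
        dist (node a b m i) (node a b m (i + 1))) := by
  have h1 : (0 : ℝ) < (b - a) / (m + 1) := div_pos (by linarith) (by positivity)
  have h2 := node_succ_sub (a := a) (b := b) m i
  rw [setLIntegral_congr_fun (g := fun _ => ENNReal.ofReal (nodeSlope a b f m i ^ 2))
    measurableSet_Ico (fun s hs => by simp only [nodeIndex_eq hab m i hs])]
  rw [setLIntegral_const, Real.volume_Ico, ← ENNReal.ofReal_mul (sq_nonneg _), nodeSlope,
    dist_comm, Real.dist_eq, ← neg_sub (node a b m (i + 1)) (node a b m i), h2, abs_of_pos h1]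
  congr 1
  generalize (b - a) / ((m : ℝ) + 1) = h at h1
  field_simp

lemma lintegral_nodeSlope_le {a b : ℝ} (hab : a < b) (f : ℝ → ℝ) (m : ℕ) :
    ∫⁻ s in Ico a b, ENNReal.ofReal (nodeSlope a b f m (nodeIndex a b m s) ^ 2) ≤
      dirichletEnergy a b f := by
  have hcover : Ico a b ⊆ ⋃ i ∈ Finset.range (m + 1), Ico (node a b m i) (node a b m (i + 1)) := by
    intro s hs
    simp only [mem_iUnion]
    exact ⟨_, Finset.mem_range.2 (nodeIndex_lt hab m hs), mem_Ico_node hab m hs.1⟩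
  refine (lintegral_mono_set hcover).trans ?_
  have hdisj : (Finset.range (m + 1) : Set ℕ).PairwiseDisjoint
      fun i => Ico (node a b m i) (node a b m (i + 1)) :=
    fun i _ j _ hij => (node_mono hab m).pairwise_disjoint_on_Ico_succ hij
  rw [lintegral_biUnion_finset hdisj (fun i _ => measurableSet_Ico)]
  simp only [lintegral_nodeSlope_Ico hab f m]
  have h := sum_ofReal_le_dirichletEnergy f (nodes_mem_disjWithin hab m)
  dsimp only at h
  exact h

/-- The integral of `|f'|²` is at most the Dirichlet energy: apply Fatou's lemma to the difference
quotients over uniform partitions. -/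
lemma lintegral_deriv_sq_le_dirichletEnergy {a b : ℝ} (hab : a < b) {f : ℝ → ℝ}
    (hf : AbsolutelyContinuousOnInterval f a b) :
    ∫⁻ s in Icc a b, ENNReal.ofReal (deriv f s ^ 2) ≤ dirichletEnergy a b f := by
  have hlim : ∀ᵐ s ∂(volume.restrict (Ico a b)), Tendsto (fun m : ℕ =>
      ENNReal.ofReal (nodeSlope a b f m (nodeIndex a b m s) ^ 2)) atTop
      (𝓝 (ENNReal.ofReal (deriv f s ^ 2))) := by
    rw [ae_restrict_iff' measurableSet_Ico]
    filter_upwards [hf.ae_differentiableAt] with s hs hsI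
    have hd := (hs (by rw [uIcc_of_le hab.le]; exact Ico_subset_Icc_self hsI)).hasDerivAt
    refine ENNReal.tendsto_ofReal (Tendsto.pow ?_ 2)
    have hh : Tendsto (fun m : ℕ => (b - a) / ((m : ℝ) + 1)) atTop (𝓝 0) := by
      simpa [div_eq_mul_inv] using
        (tendsto_one_div_add_atTop_nhds_zero_nat (𝕜 := ℝ)).const_mul (b - a)
    have hmem := fun m : ℕ => mem_Ico_node hab m hsI.1
    refine tendsto_slope_of_straddle hd ?_ ?_ (fun m => (hmem m).1) (fun m => (hmem m).2)
    · refine tendsto_of_tendsto_of_tendsto_of_le_of_le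
        (g := fun m : ℕ => s - (b - a) / ((m : ℝ) + 1))
        (by simpa using hh.const_sub s) tendsto_const_nhds (fun m => ?_) (fun m => (hmem m).1)
      have := node_succ_sub (a := a) (b := b) m (nodeIndex a b m s)
      have := (hmem m).2
      simp only
      linarith
    · refine tendsto_of_tendsto_of_tendsto_of_le_of_le
        (h := fun m : ℕ => s + (b - a) / ((m : ℝ) + 1)) tendsto_const_nhds
        (by simpa using hh.const_add s) (fun m => (hmem m).2.le) (fun m => ?_)
      have := node_succ_sub (a := a) (b := b) m (nodeIndex a b m s)
      have := (hmem m).1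
      simp only
      linarith
  rw [setLIntegral_congr (Ico_ae_eq_Icc (a := a) (b := b)).symm]
  calc ∫⁻ s in Ico a b, ENNReal.ofReal (deriv f s ^ 2)
      = ∫⁻ s in Ico a b, liminf (fun m : ℕ =>
          ENNReal.ofReal (nodeSlope a b f m (nodeIndex a b m s) ^ 2)) atTop :=
        lintegral_congr_ae (hlim.mono fun s hs => hs.liminf_eq.symm)
    _ ≤ liminf (fun m : ℕ => ∫⁻ s in Ico a b,
          ENNReal.ofReal (nodeSlope a b f m (nodeIndex a b m s) ^ 2)) atTop := by
        refine lintegral_liminf_le fun m => ?_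
        have h1 : Measurable (nodeIndex a b m) := by
          unfold nodeIndex
          exact Nat.measurable_floor.comp (by fun_prop)
        have h2 : Measurable (nodeSlope a b f m) := measurable_from_nat
        exact ENNReal.measurable_ofReal.comp ((h2.comp h1).pow_const 2)
    _ ≤ dirichletEnergy a b f := by
        refine liminf_le_of_le (by isBoundedDefault) fun c hc => ?_
        obtain ⟨m, hm⟩ := hc.exists
        exact hm.trans (lintegral_nodeSlope_le hab f m)

lemma sq_sub_div_le_integral {x y : ℝ} (hxy : x < y) {f : ℝ → ℝ}
    (hf : AbsolutelyContinuousOnInterval f x y)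
    (h2 : IntervalIntegrable (fun s => deriv f s ^ 2) volume x y) :
    (f y - f x) ^ 2 / (y - x) ≤ ∫ s in x..y, deriv f s ^ 2 := by
  -- integrate `2 c f' - c² ≤ f'²` for the optimal constant, the mean value `c` of `f'`
  set c := (f y - f x) / (y - x) with hc
  have hne : y - x ≠ 0 := by linarith
  have h := intervalIntegral.integral_mono_on (f := fun s => 2 * c * deriv f s - c ^ 2) hxy.le
    ((hf.intervalIntegrable_deriv.const_mul (2 * c)).sub intervalIntegrable_const) h2
    (fun s _ => by nlinarith [sq_nonneg (deriv f s - c)])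
  rw [intervalIntegral.integral_sub (hf.intervalIntegrable_deriv.const_mul (2 * c))
    intervalIntegrable_const, intervalIntegral.integral_const_mul, hf.integral_deriv_eq_sub,
    intervalIntegral.integral_const, smul_eq_mul] at h
  refine le_trans (le_of_eq ?_) h
  rw [hc]
  field_simp
  ring

lemma dirichletEnergy_le_lintegral {a b : ℝ} (hab : a < b) {f : ℝ → ℝ}
    (hf : AbsolutelyContinuousOnInterval f a b) :
    dirichletEnergy a b f ≤ ∫⁻ s in Icc a b, ENNReal.ofReal (deriv f s ^ 2) := by
  by_cases htop : ∫⁻ s in Icc a b, ENNReal.ofReal (deriv f s ^ 2) = ∞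
  · rw [htop]; exact le_top
  have hint : IntegrableOn (fun s => deriv f s ^ 2) (Icc a b) := by
    refine ⟨((measurable_deriv f).pow_const 2).aestronglyMeasurable, ?_⟩
    rw [hasFiniteIntegral_iff_ofReal (ae_of_all _ fun s => sq_nonneg _)]
    exact lt_top_iff_ne_top.2 htop
  have key : ∀ x ∈ Icc a b, ∀ y ∈ Icc a b, ENNReal.ofReal ((f x - f y) ^ 2 / dist x y) ≤
      ∫⁻ s in uIoc x y, ENNReal.ofReal (deriv f s ^ 2) := by
    have main : ∀ x ∈ Icc a b, ∀ y ∈ Icc a b, x < y →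
        ENNReal.ofReal ((f x - f y) ^ 2 / dist x y) ≤
        ∫⁻ s in uIoc x y, ENNReal.ofReal (deriv f s ^ 2) := by
      intro x hx y hy hxy
      have hsub : uIcc x y ⊆ uIcc a b := by
        rw [uIcc_of_le hab.le, uIcc_of_le hxy.le]; exact Icc_subset_Icc hx.1 hy.2
      have hint' : IntegrableOn (fun s => deriv f s ^ 2) (Ioc x y) :=
        hint.mono_set (Ioc_subset_Icc_self.trans (Icc_subset_Icc hx.1 hy.2))
      rw [uIoc_of_le hxy.le, ← ofReal_integral_eq_lintegral_ofReal hint'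
        (ae_of_all _ fun s => sq_nonneg _)]
      refine ENNReal.ofReal_le_ofReal ?_
      have := sq_sub_div_le_integral hxy (hf.mono hsub)
        ((intervalIntegrable_iff_integrableOn_Ioc_of_le hxy.le).2 hint')
      rw [intervalIntegral.integral_of_le hxy.le] at this
      rw [dist_comm, Real.dist_eq, abs_of_pos (by linarith), ← neg_sub (f y), neg_sq]
      exact this
    intro x hx y hy
    rcases lt_trichotomy x y with h | h | h
    · exact main x hx y hy h
    · simp [h]
    · have := main y hy x hx h
      rwa [dist_comm, uIoc_comm, ← neg_sub (f x), neg_sq] at this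
  refine iSup₂_le fun E hE => ?_
  have hsub := biUnion_uIoc_subset_of_mem_disjWithin (n := E.1) (I := E.2) hE
  have hm := hE.1
  rw [uIcc_of_le hab.le] at hm
  calc _ ≤ ∑ i ∈ Finset.range E.1,
        ∫⁻ s in uIoc (E.2 i).1 (E.2 i).2, ENNReal.ofReal (deriv f s ^ 2) :=
        Finset.sum_le_sum fun i hi => key _ (hm i hi).1 _ (hm i hi).2
    _ = ∫⁻ s in ⋃ i ∈ Finset.range E.1, uIoc (E.2 i).1 (E.2 i).2,
        ENNReal.ofReal (deriv f s ^ 2) := by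
        rw [lintegral_biUnion_finset hE.2 fun _ _ => measurableSet_uIoc]
    _ ≤ _ := by
        refine lintegral_mono_set (hsub.trans ?_)
        rw [uIoc_of_le hab.le]
        exact Ioc_subset_Icc_self

lemma dirichletEnergy_eq_lintegral {a b : ℝ} (hab : a < b) {f : ℝ → ℝ}
    (hf : AbsolutelyContinuousOnInterval f a b) :
    dirichletEnergy a b f = ∫⁻ s in Icc a b, ENNReal.ofReal (deriv f s ^ 2) :=
  le_antisymm (dirichletEnergy_le_lintegral hab hf) (lintegral_deriv_sq_le_dirichletEnergy hab hf)

/-- A supremum of functions of finitely many values of `f` is lower semicontinuous for pointwise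
convergence. -/
lemma lowerSemicontinuous_dirichletEnergy {X : Type*} [TopologicalSpace X] (a b : ℝ)
    {F : X → ℝ → ℝ} (hF : ∀ s, Continuous fun x => F x s) :
    LowerSemicontinuous fun x => dirichletEnergy a b (F x) := by
  refine lowerSemicontinuous_iSup fun E => lowerSemicontinuous_iSup fun _ => ?_
  refine Continuous.lowerSemicontinuous ?_
  refine continuous_finsetSum _ fun i _ => ENNReal.continuous_ofReal.comp ?_
  exact (((hF _).sub (hF _)).pow 2).div_const _

lemma dirichletEnergy_congr {a b : ℝ} {f g : ℝ → ℝ} (h : EqOn f g (uIcc a b)) :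
    dirichletEnergy a b f = dirichletEnergy a b g := by
  refine biSup_congr fun E hE => Finset.sum_congr rfl fun i hi => ?_
  rw [h (hE.1 i hi).1, h (hE.1 i hi).2]

/-! ### Matrix valued curves and `H¹([a, b], O(n))` -/

lemma hasDerivWithinAt_matrix {g : ℝ → Matrix (Fin n) (Fin m) ℝ} {g' : Matrix (Fin n) (Fin m) ℝ}
    {t : Set ℝ} {s : ℝ} :
    HasDerivWithinAt g g' t s ↔ ∀ i j, HasDerivWithinAt (fun s => g s i j) (g' i j) t s :=
  ⟨fun h i j => hasDerivWithinAt_pi.1 (hasDerivWithinAt_pi.1 h i) j,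
    fun h => hasDerivWithinAt_pi.2 fun i => hasDerivWithinAt_pi.2 fun j => h i j⟩

lemma memLp_matrix {g : ℝ → Matrix (Fin n) (Fin m) ℝ} {p : ℝ≥0∞} {μ : Measure ℝ} :
    MemLp g p μ ↔ ∀ i j, MemLp (fun s => g s i j) p μ :=
  ⟨fun h i j => memLp_pi_iff.1 (memLp_pi_iff.1 h i) j,
    fun h => memLp_pi_iff.2 fun i => memLp_pi_iff.2 fun j => h i j⟩

lemma contDiffOn_matrix {g : ℝ → Matrix (Fin n) (Fin m) ℝ} {t : Set ℝ} {r : WithTop ℕ∞} :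
    ContDiffOn ℝ r g t ↔ ∀ i j, ContDiffOn ℝ r (fun s => g s i j) t :=
  ⟨fun h i j => contDiffOn_pi.1 (contDiffOn_pi.1 h i) j,
    fun h => contDiffOn_pi.2 fun i => contDiffOn_pi.2 fun j => h i j⟩

lemma hasDerivWithinAt_matrix_mul {A : ℝ → Matrix (Fin n) (Fin m) ℝ}
    {B : ℝ → Matrix (Fin m) (Fin k) ℝ} {A' : Matrix (Fin n) (Fin m) ℝ}
    {B' : Matrix (Fin m) (Fin k) ℝ} {t : Set ℝ} {s : ℝ}
    (hA : HasDerivWithinAt A A' t s) (hB : HasDerivWithinAt B B' t s) :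
    HasDerivWithinAt (fun s => A s * B s) (A' * B s + A s * B') t s := by
  rw [hasDerivWithinAt_matrix] at hA hB ⊢
  intro i j
  simp only [Matrix.add_apply, Matrix.mul_apply, ← Finset.sum_add_distrib]
  exact HasDerivWithinAt.fun_sum fun l _ => (hA i l).mul (hB l j)

lemma absolutelyContinuousOnInterval_matrix {g : ℝ → Matrix (Fin n) (Fin m) ℝ} {a b : ℝ} :
    AbsolutelyContinuousOnInterval g a b ↔
      ∀ i j, AbsolutelyContinuousOnInterval (fun s => g s i j) a b := by
  constructor
  · intro h i j
    refine squeeze_zero (fun E => Finset.sum_nonneg fun _ _ => dist_nonneg) (fun E => ?_) h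
    refine Finset.sum_le_sum fun l _ => ?_
    exact (dist_le_pi_dist (g (E.2 l).1 i) (g (E.2 l).2 i) j).trans
      (dist_le_pi_dist (g (E.2 l).1) (g (E.2 l).2) i)
  · intro h
    have h' := tendsto_finsetSum Finset.univ fun i _ => tendsto_finsetSum Finset.univ
      fun j _ => h i j
    simp only [Finset.sum_const_zero] at h'
    refine squeeze_zero (fun E => Finset.sum_nonneg fun _ _ => dist_nonneg) (fun E => ?_) h'
    have hc : ∀ i, ∑ j, ∑ l ∈ Finset.range E.1, dist (g (E.2 l).1 i j) (g (E.2 l).2 i j) =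
        ∑ l ∈ Finset.range E.1, ∑ j, dist (g (E.2 l).1 i j) (g (E.2 l).2 i j) :=
      fun i => Finset.sum_comm
    simp only [hc]
    rw [Finset.sum_comm]
    refine Finset.sum_le_sum fun l _ => ?_
    have hn : 0 ≤ ∑ i, ∑ j, dist (g (E.2 l).1 i j) (g (E.2 l).2 i j) :=
      Finset.sum_nonneg fun i _ => Finset.sum_nonneg fun j _ => dist_nonneg
    refine (dist_pi_le_iff hn).2 fun i => (dist_pi_le_iff hn).2 fun j => ?_
    refine (Finset.single_le_sum (f := fun j => dist (g (E.2 l).1 i j) (g (E.2 l).2 i j))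
      (fun _ _ => dist_nonneg) (Finset.mem_univ j)).trans ?_
    exact Finset.single_le_sum (f := fun i => ∑ j, dist (g (E.2 l).1 i j) (g (E.2 l).2 i j))
      (fun _ _ => Finset.sum_nonneg fun _ _ => dist_nonneg) (Finset.mem_univ i)

/-- The Sobolev space `H¹(a, b)` of real functions, in terms of absolute continuity. -/
structure IsSobolev (a b : ℝ) (f : ℝ → ℝ) : Prop where
  ac : AbsolutelyContinuousOnInterval f a b
  memLp : MemLp (deriv f) 2 (volume.restrict (Icc a b))

lemma ae_hasDerivAt_of_absolutelyContinuous {a b : ℝ} (hab : a < b) {f : ℝ → ℝ}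
    (hf : AbsolutelyContinuousOnInterval f a b) :
    ∀ᵐ s ∂(volume.restrict (Icc a b)), HasDerivAt f (deriv f s) s := by
  rw [ae_restrict_iff' measurableSet_Icc]
  filter_upwards [hf.ae_differentiableAt] with s hs hsI
  exact (hs (by rwa [uIcc_of_le hab.le])).hasDerivAt

lemma ae_mem_Icc {a b : ℝ} {μ : Measure ℝ} : ∀ᵐ s ∂(μ.restrict (Icc a b)), s ∈ Icc a b :=
  ae_restrict_mem measurableSet_Icc

lemma ae_Icc_mem_nhds {a b : ℝ} : ∀ᵐ s ∂(volume.restrict (Icc a b)), Icc a b ∈ 𝓝 s := by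
  rw [← Measure.restrict_congr_set (Ioo_ae_eq_Icc (a := a) (b := b)),
    ae_restrict_iff' measurableSet_Ioo]
  exact ae_of_all _ fun s hs => Icc_mem_nhds hs.1 hs.2

lemma memLp_continuousOn_mul {a b : ℝ} {f h : ℝ → ℝ} (hf : ContinuousOn f (Icc a b))
    (hh : MemLp h 2 (volume.restrict (Icc a b))) :
    MemLp (fun s => f s * h s) 2 (volume.restrict (Icc a b)) := by
  obtain ⟨C, hC⟩ := isCompact_Icc.exists_bound_of_continuousOn hf
  refine (hh.const_mul C).mono
    ((hf.aestronglyMeasurable measurableSet_Icc).mul hh.aestronglyMeasurable) ?_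
  filter_upwards [ae_mem_Icc] with s hs
  rw [norm_mul, norm_mul]
  exact mul_le_mul_of_nonneg_right ((hC s hs).trans (le_abs_self C)) (norm_nonneg _)

lemma IsSobolev.mul {a b : ℝ} (hab : a < b) {f h : ℝ → ℝ} (hf : IsSobolev a b f)
    (hh : IsSobolev a b h) : IsSobolev a b (fun s => f s * h s) := by
  refine ⟨hf.ac.fun_mul hh.ac, ?_⟩
  have hfc := hf.ac.continuousOn
  have hhc := hh.ac.continuousOn
  rw [uIcc_of_le hab.le] at hfc hhc
  refine ((memLp_continuousOn_mul hhc hf.memLp).add (memLp_continuousOn_mul hfc hh.memLp)).ae_eq ?_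
  filter_upwards [ae_hasDerivAt_of_absolutelyContinuous hab hf.ac,
    ae_hasDerivAt_of_absolutelyContinuous hab hh.ac] with s h1 h2
  rw [(h1.fun_mul h2).deriv, Pi.add_apply, mul_comm (h s)]

lemma IsSobolev.sum {a b : ℝ} (hab : a < b) {ι : Type*} (t : Finset ι) {f : ι → ℝ → ℝ}
    (hf : ∀ i ∈ t, IsSobolev a b (f i)) : IsSobolev a b (fun s => ∑ i ∈ t, f i s) := by
  classical
  induction t using Finset.induction_on with
  | empty =>
    refine ⟨?_, by simp⟩
    simpa using (contDiffOn_const (c := (0 : ℝ)) (n := 1)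
      (s := uIcc a b)).absolutelyContinuousOnInterval
  | insert i t hi ih =>
    have h1 := hf i (Finset.mem_insert_self i t)
    have h2 := ih fun j hj => hf j (Finset.mem_insert_of_mem hj)
    simp only [Finset.sum_insert hi]
    refine ⟨h1.ac.fun_add h2.ac, (h1.memLp.add h2.memLp).ae_eq ?_⟩
    filter_upwards [ae_hasDerivAt_of_absolutelyContinuous hab h1.ac,
      ae_hasDerivAt_of_absolutelyContinuous hab h2.ac] with s h3 h4
    exact (h3.fun_add h4).deriv.symm

lemma isSobolev_of_contDiff {a b : ℝ} {f : ℝ → ℝ} (hf : ContDiff ℝ 1 f) : IsSobolev a b f := by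
  refine ⟨hf.contDiffOn.absolutelyContinuousOnInterval, ?_⟩
  have hc : ContinuousOn (deriv f) (Icc a b) := (hf.continuous_deriv le_rfl).continuousOn
  obtain ⟨C, hC⟩ := isCompact_Icc.exists_bound_of_continuousOn hc
  refine MemLp.of_bound (hc.aestronglyMeasurable measurableSet_Icc) C ?_
  filter_upwards [ae_mem_Icc] with s hs using hC s hs

lemma isSobolev_of_dirichletEnergy {a b : ℝ} (hab : a < b) {f : ℝ → ℝ}
    (hf : dirichletEnergy a b f ≠ ∞) : IsSobolev a b f := by
  have hac := absolutelyContinuousOnInterval_of_dirichletEnergy hf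
  refine ⟨hac, (memLp_two_iff_integrable_sq (measurable_deriv f).aestronglyMeasurable).2
    ⟨((measurable_deriv f).pow_const 2).aestronglyMeasurable, ?_⟩⟩
  rw [hasFiniteIntegral_iff_ofReal (ae_of_all _ fun s => sq_nonneg _),
    ← dirichletEnergy_eq_lintegral hab hac]
  exact lt_top_iff_ne_top.2 hf

lemma IsSobolev.integrable_sq {a b : ℝ} {f : ℝ → ℝ} (hf : IsSobolev a b f) :
    Integrable (fun s => deriv f s ^ 2) (volume.restrict (Icc a b)) :=
  hf.memLp.integrable_sq

lemma IsSobolev.dirichletEnergy_eq {a b : ℝ} (hab : a < b) {f : ℝ → ℝ} (hf : IsSobolev a b f) :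
    dirichletEnergy a b f = ENNReal.ofReal (∫ s in Icc a b, deriv f s ^ 2) := by
  rw [dirichletEnergy_eq_lintegral hab hf.ac, ofReal_integral_eq_lintegral_ofReal hf.integrable_sq
    (ae_of_all _ fun s => sq_nonneg _)]

lemma ae_hasDerivAt_matrix {a b : ℝ} (hab : a < b) {g : ℝ → Matrix (Fin n) (Fin m) ℝ}
    (hg : ∀ i j, AbsolutelyContinuousOnInterval (fun s => g s i j) a b) :
    ∀ᵐ s ∂(volume.restrict (Icc a b)), HasDerivAt g (derivWithin g (Icc a b) s) s ∧
      ∀ i j, derivWithin g (Icc a b) s i j = deriv (fun s => g s i j) s := by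
  have h : ∀ᵐ s ∂(volume.restrict (Icc a b)), ∀ i j,
      HasDerivAt (fun s => g s i j) (deriv (fun s => g s i j) s) s := by
    rw [ae_all_iff]; intro i
    rw [ae_all_iff]; intro j
    exact ae_hasDerivAt_of_absolutelyContinuous hab (hg i j)
  filter_upwards [h, ae_Icc_mem_nhds] with s hs hn
  have h1 : HasDerivWithinAt g (Matrix.of fun i j => deriv (fun s => g s i j) s) (Icc a b) s :=
    hasDerivWithinAt_matrix.2 fun i j => (hs i j).hasDerivWithinAt
  have h2 : derivWithin g (Icc a b) s = Matrix.of fun i j => deriv (fun s => g s i j) s :=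
    h1.derivWithin (uniqueDiffOn_Icc hab s (mem_of_mem_nhds hn))
  rw [h2]
  exact ⟨h1.hasDerivAt hn, fun i j => rfl⟩

/-- Membership in `H¹([a, b], O(n))` can be checked entry by entry. -/
lemma mem_H1_iff {a b : ℝ} (hab : a < b) {g : ℝ → Matrix (Fin n) (Fin n) ℝ} :
    g ∈ H1 a b n ↔ (∀ s ∈ Icc a b, g s ∈ Matrix.orthogonalGroup (Fin n) ℝ) ∧
      ∀ i j, IsSobolev a b (fun s => g s i j) := by
  constructor
  · rintro ⟨h1, h2, h3⟩
    rw [absolutelyContinuousOnInterval_matrix] at h2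
    rw [memLp_matrix] at h3
    refine ⟨h1, fun i j => ⟨h2 i j, (h3 i j).ae_eq ?_⟩⟩
    filter_upwards [ae_hasDerivAt_matrix hab h2] with s hs using hs.2 i j
  · rintro ⟨h1, h2⟩
    refine ⟨h1, absolutelyContinuousOnInterval_matrix.2 fun i j => (h2 i j).ac,
      memLp_matrix.2 fun i j => (h2 i j).memLp.ae_eq ?_⟩
    filter_upwards [ae_hasDerivAt_matrix hab fun i j => (h2 i j).ac] with s hs
    exact (hs.2 i j).symm

lemma mem_orthogonalGroup_iff_transpose {A : Matrix (Fin n) (Fin n) ℝ} :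
    A ∈ Matrix.orthogonalGroup (Fin n) ℝ ↔ Aᵀ * A = 1 := by
  rw [Matrix.mem_orthogonalGroup_iff']

lemma inv_eq_transpose {A : Matrix (Fin n) (Fin n) ℝ}
    (hA : A ∈ Matrix.orthogonalGroup (Fin n) ℝ) : A⁻¹ = Aᵀ :=
  Matrix.inv_eq_left_inv (mem_orthogonalGroup_iff_transpose.1 hA)

lemma mul_transpose_of_mem {A : Matrix (Fin n) (Fin n) ℝ}
    (hA : A ∈ Matrix.orthogonalGroup (Fin n) ℝ) : A * Aᵀ = 1 :=
  mul_eq_one_comm.1 (mem_orthogonalGroup_iff_transpose.1 hA)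

lemma innerO_self (X : Matrix (Fin n) (Fin n) ℝ) : innerO X X = ∑ i, ∑ j, X i j ^ 2 := by
  simp only [innerO, Matrix.trace, Matrix.diag, Matrix.mul_apply, Matrix.transpose_apply, sq]
  exact Finset.sum_comm

lemma innerO_transpose_mul {A X : Matrix (Fin n) (Fin n) ℝ}
    (hA : A ∈ Matrix.orthogonalGroup (Fin n) ℝ) : innerO (Aᵀ * X) (Aᵀ * X) = innerO X X := by
  simp only [innerO, Matrix.transpose_mul, Matrix.transpose_transpose]
  rw [Matrix.mul_assoc, ← Matrix.mul_assoc A, mul_transpose_of_mem hA, Matrix.one_mul]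

lemma innerO_mul {A X : Matrix (Fin n) (Fin n) ℝ}
    (hA : A ∈ Matrix.orthogonalGroup (Fin n) ℝ) : innerO (X * A) (X * A) = innerO X X := by
  simp only [innerO, Matrix.transpose_mul]
  rw [Matrix.mul_assoc, Matrix.trace_mul_comm, Matrix.mul_assoc, Matrix.mul_assoc,
    mul_transpose_of_mem hA, Matrix.mul_one]

lemma innerO_add_smul (X σ : Matrix (Fin n) (Fin n) ℝ) (r : ℝ) :
    innerO (X + r • σ) (X + r • σ) = innerO X X + 2 * r * innerO X σ + r ^ 2 * innerO σ σ := by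
  have : (σᵀ * X).trace = (Xᵀ * σ).trace := by
    rw [← Matrix.trace_transpose]; simp
  simp only [innerO, Matrix.transpose_add, Matrix.transpose_smul, Matrix.add_mul, Matrix.mul_add,
    Matrix.trace_add, Matrix.smul_mul, Matrix.mul_smul, Matrix.trace_smul, smul_eq_mul, this]
  ring

/-- Left translation is an isometry, so the kinetic energy density is the squared Frobenius norm of
the derivative. -/
lemma innerO_bodyVel {a b : ℝ} {g : ℝ → Matrix (Fin n) (Fin n) ℝ} {s : ℝ}
    (hg : g s ∈ Matrix.orthogonalGroup (Fin n) ℝ) :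
    innerO (bodyVel a b g s) (bodyVel a b g s) =
      ∑ i, ∑ j, derivWithin g (Icc a b) s i j ^ 2 := by
  rw [bodyVel, inv_eq_transpose hg, innerO_transpose_mul hg, innerO_self]

lemma innerO_bodyVel_ae {a b : ℝ} (hab : a < b) {g : ℝ → Matrix (Fin n) (Fin n) ℝ}
    (hg : g ∈ H1 a b n) :
    (fun s => innerO (bodyVel a b g s) (bodyVel a b g s)) =ᵐ[volume.restrict (Icc a b)]
      fun s => ∑ i, ∑ j, deriv (fun s => g s i j) s ^ 2 := by
  have h := (mem_H1_iff hab).1 hg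
  filter_upwards [ae_mem_Icc, ae_hasDerivAt_matrix hab fun i j => (h.2 i j).ac] with s hs hd
  rw [innerO_bodyVel (h.1 s hs)]
  simp only [hd.2]

lemma integrable_innerO_bodyVel {a b : ℝ} (hab : a < b) {g : ℝ → Matrix (Fin n) (Fin n) ℝ}
    (hg : g ∈ H1 a b n) :
    Integrable (fun s => innerO (bodyVel a b g s) (bodyVel a b g s))
      (volume.restrict (Icc a b)) := by
  refine Integrable.congr ?_ (innerO_bodyVel_ae hab hg).symm
  exact integrable_finsetSum _ fun i _ => integrable_finsetSum _ fun j _ =>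
    (((mem_H1_iff hab).1 hg).2 i j).integrable_sq

/-- The Dirichlet energy of a curve of matrices, measured entry by entry. -/
noncomputable def matrixEnergy (a b : ℝ) (g : ℝ → Matrix (Fin n) (Fin n) ℝ) : ℝ≥0∞ :=
  ∑ i, ∑ j, dirichletEnergy a b (fun s => g s i j)

lemma matrixEnergy_eq {a b : ℝ} (hab : a < b) {g : ℝ → Matrix (Fin n) (Fin n) ℝ}
    (hg : g ∈ H1 a b n) :
    matrixEnergy a b g =
      ENNReal.ofReal (∫ s in Icc a b, innerO (bodyVel a b g s) (bodyVel a b g s)) := by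
  have h := ((mem_H1_iff hab).1 hg).2
  have hn : ∀ i j, 0 ≤ ∫ s in Icc a b, deriv (fun s => g s i j) s ^ 2 :=
    fun i j => integral_nonneg fun s => sq_nonneg _
  rw [integral_congr_ae (innerO_bodyVel_ae hab hg), integral_finsetSum _ fun i _ =>
    integrable_finsetSum _ fun j _ => (h i j).integrable_sq,
    ENNReal.ofReal_sum_of_nonneg fun i _ => integral_nonneg fun s =>
      Finset.sum_nonneg fun j _ => sq_nonneg _]
  refine Finset.sum_congr rfl fun i _ => ?_
  rw [integral_finsetSum _ fun j _ => (h i j).integrable_sq,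
    ENNReal.ofReal_sum_of_nonneg fun j _ => hn i j]
  exact Finset.sum_congr rfl fun j _ => (h i j).dirichletEnergy_eq hab

lemma mem_H1_of_matrixEnergy {a b : ℝ} (hab : a < b) {g : ℝ → Matrix (Fin n) (Fin n) ℝ}
    (hO : ∀ s ∈ Icc a b, g s ∈ Matrix.orthogonalGroup (Fin n) ℝ)
    (hg : matrixEnergy a b g ≠ ∞) : g ∈ H1 a b n := by
  refine (mem_H1_iff hab).2 ⟨hO, fun i j => isSobolev_of_dirichletEnergy hab ?_⟩
  rw [matrixEnergy, ENNReal.sum_ne_top] at hg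
  exact (ENNReal.sum_ne_top.1 (hg i (Finset.mem_univ i))) j (Finset.mem_univ j)

lemma bodyVel_of_hasDerivWithinAt {a b : ℝ} (hab : a < b) {g : ℝ → Matrix (Fin n) (Fin n) ℝ}
    {g' : Matrix (Fin n) (Fin n) ℝ} {s : ℝ} (hs : s ∈ Icc a b)
    (hO : g s ∈ Matrix.orthogonalGroup (Fin n) ℝ) (hg : HasDerivWithinAt g g' (Icc a b) s) :
    bodyVel a b g s = (g s)ᵀ * g' := by
  have h : derivWithin g (Icc a b) s = g' := hg.derivWithin (uniqueDiffOn_Icc hab s hs)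
  rw [bodyVel, inv_eq_transpose hO, h]

/-- The body velocity of a curve in `O(n)` is antisymmetric wherever the curve is differentiable:
differentiate `gᵀ g = 1`. -/
lemma transpose_bodyVel {a b : ℝ} (hab : a < b) {g : ℝ → Matrix (Fin n) (Fin n) ℝ}
    {g' : Matrix (Fin n) (Fin n) ℝ} {s : ℝ} (hs : s ∈ Icc a b)
    (hO : ∀ s ∈ Icc a b, g s ∈ Matrix.orthogonalGroup (Fin n) ℝ)
    (hg : HasDerivWithinAt g g' (Icc a b) s) :
    (bodyVel a b g s)ᵀ = -bodyVel a b g s := by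
  have hgT : HasDerivWithinAt (fun s => (g s)ᵀ) g'ᵀ (Icc a b) s :=
    hasDerivWithinAt_matrix.2 fun i j => hasDerivWithinAt_matrix.1 hg j i
  have h1 := hasDerivWithinAt_matrix_mul hgT hg
  have h2 : HasDerivWithinAt (fun s => (g s)ᵀ * g s) 0 (Icc a b) s :=
    (hasDerivWithinAt_const s (Icc a b) (1 : Matrix (Fin n) (Fin n) ℝ)).congr
      (fun t ht => mem_orthogonalGroup_iff_transpose.1 (hO t ht))
      (mem_orthogonalGroup_iff_transpose.1 (hO s hs))
  have h3 := (uniqueDiffOn_Icc hab s hs).eq_deriv (Icc a b) h1 h2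
  rw [bodyVel_of_hasDerivWithinAt hab hs (hO s hs) hg, Matrix.transpose_mul,
    Matrix.transpose_transpose]
  exact eq_neg_of_add_eq_zero_left h3

lemma hasDerivAt_exp_smul (σ : Matrix (Fin n) (Fin n) ℝ) (t : ℝ) :
    HasDerivAt (fun u : ℝ => NormedSpace.exp (u • σ)) (NormedSpace.exp (t • σ) * σ) t := by
  let _ := @Matrix.linftyOpNormedRing (Fin n) ℝ _ _ _
  let _ := @Matrix.linftyOpNormedAlgebra ℝ (Fin n) ℝ _ _ _ _ _
  have hc : CompleteSpace (Fin n → Fin n → ℝ) := inferInstance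
  exact @hasDerivAt_exp_smul_const ℝ (Matrix (Fin n) (Fin n) ℝ) _ _ _ hc σ t

lemma exp_smul_mem_orthogonalGroup {σ : Matrix (Fin n) (Fin n) ℝ} (hσ : σᵀ = -σ) (t : ℝ) :
    NormedSpace.exp (t • σ) ∈ Matrix.orthogonalGroup (Fin n) ℝ := by
  rw [mem_orthogonalGroup_iff_transpose, ← Matrix.exp_transpose, Matrix.transpose_smul, hσ,
    smul_neg, Matrix.exp_neg]
  exact Matrix.nonsing_inv_mul _ ((Matrix.isUnit_iff_isUnit_det _).1 (Matrix.isUnit_exp _))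

lemma commute_exp_smul (σ : Matrix (Fin n) (Fin n) ℝ) (t : ℝ) :
    NormedSpace.exp (t • σ) * σ = σ * NormedSpace.exp (t • σ) := by
  let _ := @Matrix.linftyOpNormedRing (Fin n) ℝ _ _ _
  let _ := @Matrix.linftyOpNormedAlgebra ℝ (Fin n) ℝ _ _ _ _ _
  exact (((Commute.refl σ).smul_right t).exp_right).eq.symm

lemma contDiff_exp_smul_apply (σ : Matrix (Fin n) (Fin n) ℝ) (i j : Fin n) :
    ContDiff ℝ 1 fun t : ℝ => NormedSpace.exp (t • σ) i j := by
  have hd : ∀ i j t, HasDerivAt (fun t : ℝ => NormedSpace.exp (t • σ) i j)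
      ((NormedSpace.exp (t • σ) * σ) i j) t := fun i j t =>
    (hasDerivWithinAt_matrix.1 (hasDerivAt_exp_smul σ t).hasDerivWithinAt i j).hasDerivAt univ_mem
  rw [contDiff_one_iff_deriv]
  refine ⟨fun t => (hd i j t).differentiableAt, ?_⟩
  rw [show deriv (fun t : ℝ => NormedSpace.exp (t • σ) i j) = fun t =>
    (NormedSpace.exp (t • σ) * σ) i j from funext fun t => (hd i j t).deriv]
  simp only [Matrix.mul_apply]
  refine continuous_finsetSum _ fun l _ => Continuous.mul ?_ continuous_const
  exact continuous_iff_continuousAt.2 fun t => (hd i l t).continuousAt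

/-- The variation `g exp (ε φ σ)` of a curve `g` in the direction `φ σ`, where `σ` is a fixed
antisymmetric matrix and `φ` a function. -/
noncomputable def variation (g : ℝ → Matrix (Fin n) (Fin n) ℝ) (σ : Matrix (Fin n) (Fin n) ℝ)
    (φ : ℝ → ℝ) (ε : ℝ) (s : ℝ) : Matrix (Fin n) (Fin n) ℝ :=
  g s * NormedSpace.exp ((ε * φ s) • σ)

lemma variation_mem_H1 {a b : ℝ} (hab : a < b) {g : ℝ → Matrix (Fin n) (Fin n) ℝ}
    (hg : g ∈ H1 a b n) {σ : Matrix (Fin n) (Fin n) ℝ} (hσ : σᵀ = -σ) {φ : ℝ → ℝ}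
    (hφ : ContDiff ℝ 1 φ) (ε : ℝ) : variation g σ φ ε ∈ H1 a b n := by
  rw [mem_H1_iff hab] at hg ⊢
  refine ⟨fun s hs => mul_mem (hg.1 s hs) (exp_smul_mem_orthogonalGroup hσ _), fun i j => ?_⟩
  simp only [variation, Matrix.mul_apply]
  refine IsSobolev.sum hab _ fun l _ => (hg.2 i l).mul hab (isSobolev_of_contDiff ?_)
  exact (contDiff_exp_smul_apply σ l j).comp (contDiff_const.mul hφ)

/-- Since `exp (ε φ σ)` commutes with `σ`, the kinetic energy of the variation is exactly quadratic
in `ε`. -/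
lemma innerO_bodyVel_variation {a b : ℝ} (hab : a < b) {g : ℝ → Matrix (Fin n) (Fin n) ℝ}
    {g' : Matrix (Fin n) (Fin n) ℝ} {s : ℝ} (hs : s ∈ Icc a b)
    (hO : g s ∈ Matrix.orthogonalGroup (Fin n) ℝ) (hg : HasDerivWithinAt g g' (Icc a b) s)
    {σ : Matrix (Fin n) (Fin n) ℝ} (hσ : σᵀ = -σ) {φ : ℝ → ℝ} {φ' : ℝ}
    (hφ : HasDerivAt φ φ' s) (ε : ℝ) :
    innerO (bodyVel a b (variation g σ φ ε) s) (bodyVel a b (variation g σ φ ε) s) =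
      innerO (bodyVel a b g s) (bodyVel a b g s) + 2 * (ε * φ') * innerO (bodyVel a b g s) σ +
        (ε * φ') ^ 2 * innerO σ σ := by
  set R := NormedSpace.exp ((ε * φ s) • σ) with hR
  have hRO : R ∈ Matrix.orthogonalGroup (Fin n) ℝ := exp_smul_mem_orthogonalGroup hσ _
  have hRd : HasDerivWithinAt (fun s => NormedSpace.exp ((ε * φ s) • σ)) ((ε * φ') • (R * σ))
      (Icc a b) s :=
    ((hasDerivAt_exp_smul σ (ε * φ s)).scomp (h := fun s => ε * φ s) s
      (hφ.const_mul ε)).hasDerivWithinAt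
  have hd : HasDerivWithinAt (variation g σ φ ε) (g' * R + g s * ((ε * φ') • (R * σ)))
      (Icc a b) s := hasDerivWithinAt_matrix_mul hg hRd
  have hv : variation g σ φ ε s = g s * R := rfl
  have hkey : bodyVel a b (variation g σ φ ε) s = Rᵀ * ((bodyVel a b g s + (ε * φ') • σ) * R) := by
    rw [bodyVel_of_hasDerivWithinAt hab hs (by rw [hv]; exact mul_mem hO hRO) hd,
      bodyVel_of_hasDerivWithinAt hab hs hO hg, hv, Matrix.transpose_mul, hR, commute_exp_smul,
      ← hR]
    have h1 : (g s)ᵀ * (g s * ((ε * φ') • (σ * R))) = (ε * φ') • (σ * R) := by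
      rw [← Matrix.mul_assoc, mem_orthogonalGroup_iff_transpose.1 hO, Matrix.one_mul]
    rw [Matrix.mul_assoc, Matrix.mul_add, h1, Matrix.add_mul, Matrix.smul_mul, Matrix.mul_assoc]
  rw [hkey, innerO_transpose_mul hRO, innerO_mul hRO, innerO_add_smul]

/-! ### Existence of minimizers -/

lemma isClosed_orthogonalGroup :
    IsClosed (Matrix.orthogonalGroup (Fin n) ℝ : Set (Matrix (Fin n) (Fin n) ℝ)) := by
  have h : (Matrix.orthogonalGroup (Fin n) ℝ : Set (Matrix (Fin n) (Fin n) ℝ)) =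
      {A | Aᵀ * A = 1} := by
    ext A
    exact mem_orthogonalGroup_iff_transpose
  rw [h]
  exact isClosed_eq (by fun_prop) continuous_const

lemma isCompact_orthogonalGroup :
    IsCompact (Matrix.orthogonalGroup (Fin n) ℝ : Set (Matrix (Fin n) (Fin n) ℝ)) := by
  have hK : IsCompact (Set.pi univ fun _ : Fin n => Set.pi univ fun _ : Fin n => Icc (-1 : ℝ) 1) :=
    isCompact_univ_pi fun _ => isCompact_univ_pi fun _ => isCompact_Icc
  refine IsCompact.of_isClosed_subset hK isClosed_orthogonalGroup fun A hA => ?_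
  intro i _ j _
  exact abs_le.1 (entry_norm_bound_of_unitary hA i j)

lemma continuousOn_of_mem_H1 {a b : ℝ} (hab : a < b) {g : ℝ → Matrix (Fin n) (Fin n) ℝ}
    (hg : g ∈ H1 a b n) : ContinuousOn g (Icc a b) := by
  have := hg.2.1.continuousOn
  rwa [uIcc_of_le hab.le] at this

lemma continuousOn_comp_curve {E : Type*} [TopologicalSpace E] {a b : ℝ}
    {U : ℝ × Matrix (Fin n) (Fin n) ℝ → E}
    (hU : ContinuousOn U (Icc a b ×ˢ (Matrix.orthogonalGroup (Fin n) ℝ : Set _)))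
    {g : ℝ → Matrix (Fin n) (Fin n) ℝ} (hg : ContinuousOn g (Icc a b))
    (hO : ∀ s ∈ Icc a b, g s ∈ Matrix.orthogonalGroup (Fin n) ℝ) :
    ContinuousOn (fun s => U (s, g s)) (Icc a b) :=
  hU.comp (continuousOn_id.prodMk hg) fun s hs => ⟨hs, hO s hs⟩

lemma intervalIntegrable_potential {a b : ℝ} (hab : a < b)
    {U : ℝ × Matrix (Fin n) (Fin n) ℝ → ℝ}
    (hU : ContinuousOn U (Icc a b ×ˢ (Matrix.orthogonalGroup (Fin n) ℝ : Set _)))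
    {g : ℝ → Matrix (Fin n) (Fin n) ℝ} (hg : ContinuousOn g (Icc a b))
    (hO : ∀ s ∈ Icc a b, g s ∈ Matrix.orthogonalGroup (Fin n) ℝ) :
    IntervalIntegrable (fun s => U (s, g s)) volume a b :=
  (continuousOn_comp_curve hU hg hO).intervalIntegrable_of_Icc hab.le

lemma intervalIntegrable_innerO_bodyVel {a b : ℝ} (hab : a < b)
    {g : ℝ → Matrix (Fin n) (Fin n) ℝ} (hg : g ∈ H1 a b n) :
    IntervalIntegrable (fun s => innerO (bodyVel a b g s) (bodyVel a b g s)) volume a b :=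
  (intervalIntegrable_iff_integrableOn_Icc_of_le hab.le).2 (integrable_innerO_bodyVel hab hg)

lemma intervalIntegrable_potEnergyDensity {a b : ℝ} (hab : a < b)
    {U : ℝ × Matrix (Fin n) (Fin n) ℝ → ℝ}
    (hU : ContinuousOn U (Icc a b ×ˢ (Matrix.orthogonalGroup (Fin n) ℝ : Set _)))
    {g : ℝ → Matrix (Fin n) (Fin n) ℝ} (hg : g ∈ H1 a b n) :
    IntervalIntegrable (potEnergyDensity a b U g) volume a b :=
  (intervalIntegrable_potential hab hU (continuousOn_of_mem_H1 hab hg) hg.1).add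
    ((intervalIntegrable_innerO_bodyVel hab hg).const_mul _)

lemma potEnergy_eq {a b : ℝ} (hab : a < b)
    {U : ℝ × Matrix (Fin n) (Fin n) ℝ → ℝ}
    (hU : ContinuousOn U (Icc a b ×ˢ (Matrix.orthogonalGroup (Fin n) ℝ : Set _)))
    {g : ℝ → Matrix (Fin n) (Fin n) ℝ} (hg : g ∈ H1 a b n) :
    potEnergy a b U g = (∫ s in a..b, U (s, g s)) +
      (1 / 2) * ∫ s in Icc a b, innerO (bodyVel a b g s) (bodyVel a b g s) := by
  simp only [potEnergy, potEnergyDensity]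
  rw [intervalIntegral.integral_add
    (intervalIntegrable_potential hab hU (continuousOn_of_mem_H1 hab hg) hg.1)
    ((intervalIntegrable_innerO_bodyVel hab hg).const_mul _),
    intervalIntegral.integral_const_mul, intervalIntegral.integral_of_le hab.le,
    intervalIntegral.integral_of_le hab.le, integral_Icc_eq_integral_Ioc]

lemma matrixEnergy_congr {a b : ℝ} (hab : a < b) {f g : ℝ → Matrix (Fin n) (Fin n) ℝ}
    (h : EqOn f g (Icc a b)) : matrixEnergy a b f = matrixEnergy a b g := by
  refine Finset.sum_congr rfl fun i _ => Finset.sum_congr rfl fun j _ => dirichletEnergy_congr ?_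
  rw [uIcc_of_le hab.le]
  intro s hs
  simp only [h hs]

lemma dirichletEnergy_entry_le {a b : ℝ} (g : ℝ → Matrix (Fin n) (Fin n) ℝ) (i j : Fin n) :
    dirichletEnergy a b (fun s => g s i j) ≤ matrixEnergy a b g :=
  (Finset.single_le_sum (f := fun j => dirichletEnergy a b (fun s => g s i j))
    (fun _ _ => zero_le) (Finset.mem_univ j)).trans
    (Finset.single_le_sum (f := fun i => ∑ j, dirichletEnergy a b (fun s => g s i j))
      (fun _ _ => zero_le) (Finset.mem_univ i))

lemma lowerSemicontinuous_matrixEnergy {X : Type*} [TopologicalSpace X] (a b : ℝ)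
    {F : X → ℝ → Matrix (Fin n) (Fin n) ℝ} (hF : ∀ s, Continuous fun x => F x s) :
    LowerSemicontinuous fun x => matrixEnergy a b (F x) :=
  lowerSemicontinuous_sum fun i _ => lowerSemicontinuous_sum fun j _ =>
    lowerSemicontinuous_dirichletEnergy a b fun s => (hF s).matrix_elem i j

/-- Curves of bounded energy are uniformly Hölder continuous of exponent `1 / 2`. -/
lemma dist_le_sqrt_of_matrixEnergy_le {a b : ℝ} (hab : a < b)
    {g : ℝ → Matrix (Fin n) (Fin n) ℝ} {C : ℝ≥0∞} (hC : C ≠ ∞) (hg : matrixEnergy a b g ≤ C)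
    {x y : ℝ} (hx : x ∈ Icc a b) (hy : y ∈ Icc a b) :
    dist (g x) (g y) ≤ √(C.toReal * dist x y) := by
  rw [← uIcc_of_le hab.le] at hx hy
  refine (dist_pi_le_iff (Real.sqrt_nonneg _)).2 fun i =>
    (dist_pi_le_iff (Real.sqrt_nonneg _)).2 fun j => ?_
  have hle := (dirichletEnergy_entry_le (a := a) (b := b) g i j).trans hg
  have h := sq_sub_le_dirichletEnergy (ne_top_of_le_ne_top hC hle) hx hy
  rw [Real.dist_eq]
  refine Real.abs_le_sqrt (h.trans ?_)
  exact mul_le_mul_of_nonneg_right (ENNReal.toReal_mono hC hle) dist_nonneg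

/-- Continuous curves in `O(n)` whose energy is at most `C`. -/
def energySublevel {a b : ℝ} (hab : a ≤ b) (n : ℕ) (C : ℝ≥0∞) :
    Set C(Icc a b, Matrix (Fin n) (Fin n) ℝ) :=
  {g | (∀ x, g x ∈ Matrix.orthogonalGroup (Fin n) ℝ) ∧ matrixEnergy a b (IccExtend hab g) ≤ C}

/-- The sublevel sets of the energy are compact for uniform convergence: they are equicontinuous,
and closed for pointwise convergence because the energy is lower semicontinuous. -/
lemma isCompact_energySublevel {a b : ℝ} (hab : a < b) (n : ℕ) {C : ℝ≥0∞} (hC : C ≠ ∞) :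
    IsCompact (energySublevel hab.le n C) := by
  refine ArzelaAscoli.isCompact_of_equicontinuous _ ?_ ?_
  · have himg : ContinuousMap.toFun '' energySublevel hab.le n C =
        {f : Icc a b → Matrix (Fin n) (Fin n) ℝ | ∀ x, f x ∈ Matrix.orthogonalGroup (Fin n) ℝ} ∩
        {f | matrixEnergy a b (IccExtend hab.le f) ≤ C} := by
      ext f
      constructor
      · rintro ⟨g, hg, rfl⟩
        exact hg
      · rintro ⟨h1, h2⟩
        have hH : IccExtend hab.le f ∈ H1 a b n :=
          mem_H1_of_matrixEnergy hab (fun s _ => h1 _) (ne_top_of_le_ne_top hC h2)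
        have hc := continuousOn_iff_continuous_domRestrict.1 (continuousOn_of_mem_H1 hab hH)
        rw [show (Icc a b).domRestrict (IccExtend hab.le f) = f from
          funext fun x => IccExtend_val hab.le f x] at hc
        exact ⟨⟨f, hc⟩, ⟨h1, h2⟩, rfl⟩
    rw [himg]
    have hK : IsCompact {f : Icc a b → Matrix (Fin n) (Fin n) ℝ |
        ∀ x, f x ∈ Matrix.orthogonalGroup (Fin n) ℝ} := by
      have := isCompact_univ_pi fun _ : Icc a b => isCompact_orthogonalGroup (n := n)
      convert this using 1
      ext f
      simp
    refine hK.inter_right ?_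
    exact (lowerSemicontinuous_matrixEnergy a b (F := fun f : Icc a b → Matrix (Fin n) (Fin n) ℝ =>
      IccExtend hab.le f) fun s => continuous_apply _).isClosed_preimage C
  · refine Metric.equicontinuous_of_continuity_modulus (fun d => √(C.toReal * d)) ?_ _ ?_
    · have : Continuous fun d : ℝ => √(C.toReal * d) := by fun_prop
      simpa using this.tendsto 0
    · rintro x y ⟨g, hg⟩
      have := dist_le_sqrt_of_matrixEnergy_le hab hC hg.2 x.2 y.2
      rwa [IccExtend_val, IccExtend_val] at this

lemma continuousOn_integral_potential {a b : ℝ} (hab : a < b)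
    {U : ℝ × Matrix (Fin n) (Fin n) ℝ → ℝ}
    (hU : ContinuousOn U (Icc a b ×ˢ (Matrix.orthogonalGroup (Fin n) ℝ : Set _))) :
    ContinuousOn (fun g : C(Icc a b, Matrix (Fin n) (Fin n) ℝ) =>
        ∫ s in a..b, U (s, IccExtend hab.le g s))
      {g | ∀ x, g x ∈ Matrix.orthogonalGroup (Fin n) ℝ} := by
  obtain ⟨B, hB⟩ := (isCompact_Icc.prod isCompact_orthogonalGroup).exists_bound_of_continuousOn hU
  intro g hg
  have : FirstCountableTopology C(Icc a b, Matrix (Fin n) (Fin n) ℝ) :=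
    inferInstanceAs (FirstCountableTopology C(Icc a b, Fin n → Fin n → ℝ))
  refine intervalIntegral.continuousWithinAt_of_dominated_interval (bound := fun _ => B) ?_ ?_
    intervalIntegrable_const ?_
  · filter_upwards [self_mem_nhdsWithin] with f hf
    rw [uIoc_of_le hab.le]
    refine ContinuousOn.aestronglyMeasurable ?_ measurableSet_Ioc
    exact (continuousOn_comp_curve hU f.continuous.Icc_extend'.continuousOn fun s _ => hf _).mono
      Ioc_subset_Icc_self
  · filter_upwards [self_mem_nhdsWithin] with f hf
    refine ae_of_all _ fun s hs => ?_
    rw [uIoc_of_le hab.le] at hs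
    exact hB _ ⟨Ioc_subset_Icc_self hs, hf _⟩
  · refine ae_of_all _ fun s hs => ?_
    rw [uIoc_of_le hab.le] at hs
    have h1 : ContinuousWithinAt (fun f : C(Icc a b, Matrix (Fin n) (Fin n) ℝ) =>
        (s, IccExtend hab.le f s)) {g | ∀ x, g x ∈ Matrix.orthogonalGroup (Fin n) ℝ} g := by
      refine Continuous.continuousWithinAt (continuous_const.prodMk ?_)
      exact continuous_eval_const (F := C(Icc a b, Matrix (Fin n) (Fin n) ℝ)) (projIcc a b hab.le s)
    exact (hU _ ⟨Ioc_subset_Icc_self hs, hg _⟩).comp h1 fun f hf =>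
      ⟨Ioc_subset_Icc_self hs, hf _⟩

/-- The direct method: the energy attains its minimum on `H¹([a, b], O(n))`. -/
theorem exists_isMinOn_potEnergy {a b : ℝ} (hab : a < b)
    {U : ℝ × Matrix (Fin n) (Fin n) ℝ → ℝ}
    (hU : ContinuousOn U (Icc a b ×ˢ (Matrix.orthogonalGroup (Fin n) ℝ : Set _))) :
    ∃ g ∈ H1 a b n, IsMinOn (potEnergy a b U) (H1 a b n) g := by
  obtain ⟨B, hB⟩ := (isCompact_Icc.prod isCompact_orthogonalGroup).exists_bound_of_continuousOn hU
  set V : C(Icc a b, Matrix (Fin n) (Fin n) ℝ) → ℝ := fun g =>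
    ∫ s in a..b, U (s, IccExtend hab.le g s) with hV
  -- twice the energy, shifted by a constant that makes the potential part nonnegative
  set F : C(Icc a b, Matrix (Fin n) (Fin n) ℝ) → ℝ≥0∞ := fun g =>
    ENNReal.ofReal (2 * (V g + B * (b - a))) + matrixEnergy a b (IccExtend hab.le g) with hF
  have hVB : ∀ g : C(Icc a b, Matrix (Fin n) (Fin n) ℝ),
      (∀ x, g x ∈ Matrix.orthogonalGroup (Fin n) ℝ) → 0 ≤ V g + B * (b - a) := by
    intro g hg
    have h := intervalIntegral.norm_integral_le_of_norm_le_const (a := a) (b := b) (C := B)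
      (f := fun s => U (s, IccExtend hab.le g s)) (fun s hs => by
        rw [uIoc_of_le hab.le] at hs
        exact hB _ ⟨Ioc_subset_Icc_self hs, hg _⟩)
    rw [abs_of_pos (by linarith : 0 < b - a), Real.norm_eq_abs] at h
    linarith [(abs_le.1 h).1]
  have hFH : ∀ g : C(Icc a b, Matrix (Fin n) (Fin n) ℝ), ∀ h ∈ H1 a b n,
      EqOn (IccExtend hab.le g) h (Icc a b) →
      0 ≤ potEnergy a b U h + B * (b - a) ∧
      F g = ENNReal.ofReal (2 * (potEnergy a b U h + B * (b - a))) := by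
    intro g h hh hgh
    have hgO : ∀ x, g x ∈ Matrix.orthogonalGroup (Fin n) ℝ := fun x => by
      rw [← IccExtend_val hab.le g x, hgh x.2]
      exact hh.1 x x.2
    have hVh : V g = ∫ s in a..b, U (s, h s) := by
      refine intervalIntegral.integral_congr fun s hs => ?_
      rw [uIcc_of_le hab.le] at hs
      simp only [hgh hs]
    have hV0 := hVB g hgO
    have hK0 : 0 ≤ ∫ s in Icc a b, innerO (bodyVel a b h s) (bodyVel a b h s) :=
      integral_nonneg fun s => by
        rw [innerO_self]
        exact Finset.sum_nonneg fun i _ => Finset.sum_nonneg fun j _ => sq_nonneg _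
    rw [potEnergy_eq hab hU hh, ← hVh]
    refine ⟨by linarith, ?_⟩
    simp only [hF]
    rw [matrixEnergy_congr hab hgh, matrixEnergy_eq hab hh,
      ← ENNReal.ofReal_add (by linarith) hK0]
    congr 1
    ring
  have hrestr : ∀ h ∈ H1 a b n, ∃ g : C(Icc a b, Matrix (Fin n) (Fin n) ℝ),
      EqOn (IccExtend hab.le g) h (Icc a b) ∧ ∀ x, g x ∈ Matrix.orthogonalGroup (Fin n) ℝ := by
    intro h hh
    refine ⟨⟨(Icc a b).domRestrict h,
      continuousOn_iff_continuous_domRestrict.1 (continuousOn_of_mem_H1 hab hh)⟩, ?_, fun x =>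
      hh.1 x x.2⟩
    intro s hs
    rw [IccExtend_of_mem hab.le _ hs]
    rfl
  -- only curves whose energy is at most that of the constant curve `1` have to be considered
  have h1 : (fun _ => 1 : ℝ → Matrix (Fin n) (Fin n) ℝ) ∈ H1 a b n :=
    (mem_H1_iff hab).2 ⟨fun _ _ => one_mem _, fun i j => isSobolev_of_contDiff contDiff_const⟩
  obtain ⟨g₁, hg₁, hg₁O⟩ := hrestr _ h1
  have hC : F g₁ ≠ ∞ := by
    rw [(hFH g₁ _ h1 hg₁).2]
    exact ENNReal.ofReal_ne_top
  have hg₁S : g₁ ∈ energySublevel hab.le n (F g₁) := ⟨hg₁O, le_add_self⟩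
  have hlsc : LowerSemicontinuousOn F (energySublevel hab.le n (F g₁)) := by
    refine LowerSemicontinuousOn.add (ContinuousOn.lowerSemicontinuousOn ?_)
      ((lowerSemicontinuous_matrixEnergy a b fun s =>
        continuous_eval_const (F := C(Icc a b, Matrix (Fin n) (Fin n) ℝ))
          (projIcc a b hab.le s)).lowerSemicontinuousOn _)
    refine ENNReal.continuous_ofReal.comp_continuousOn (continuousOn_const.mul
      (ContinuousOn.add ?_ continuousOn_const))
    exact (continuousOn_integral_potential hab hU).mono fun g hg => hg.1
  obtain ⟨g₀, hg₀, hmin⟩ :=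
    hlsc.exists_isMinOn ⟨g₁, hg₁S⟩ (isCompact_energySublevel hab n hC)
  have hg₀H : IccExtend hab.le g₀ ∈ H1 a b n :=
    mem_H1_of_matrixEnergy hab (fun s _ => hg₀.1 _) (ne_top_of_le_ne_top hC hg₀.2)
  refine ⟨_, hg₀H, isMinOn_iff.2 fun h hh => ?_⟩
  obtain ⟨f, hf, hfO⟩ := hrestr h hh
  have hle : F g₀ ≤ F f := by
    by_cases hfS : matrixEnergy a b (IccExtend hab.le f) ≤ F g₁
    · exact isMinOn_iff.1 hmin f ⟨hfO, hfS⟩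
    · exact (isMinOn_iff.1 hmin g₁ hg₁S).trans ((not_le.1 hfS).le.trans le_add_self)
  obtain ⟨hn, he⟩ := hFH f h hh hf
  rw [(hFH g₀ _ hg₀H fun _ _ => rfl).2, he, ENNReal.ofReal_le_ofReal_iff (by linarith)] at hle
  linarith

/-! ### The first variation -/

lemma hasDerivWithinAt_integral_Icc {a b : ℝ} {q : ℝ → ℝ}
    (hq : ContinuousOn q (Icc a b)) {s : ℝ} (hs : s ∈ Icc a b) :
    HasDerivWithinAt (fun u => ∫ t in a..u, q t) (q s) (Icc a b) s := by
  have : Fact (s ∈ Icc a b) := ⟨hs⟩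
  refine intervalIntegral.integral_hasDerivWithinAt_right
    ((hq.mono (Icc_subset_Icc le_rfl hs.2)).intervalIntegrable_of_Icc hs.1) ?_ (hq s hs)
  exact hq.stronglyMeasurableAtFilter_nhdsWithin measurableSet_Icc s

/-- The lemma of du Bois-Reymond, with natural boundary conditions because the test functions
are not required to vanish at the end points. -/
lemma ae_eq_integral_of_forall_integral_eq_zero {a b : ℝ} (hab : a < b) {p q : ℝ → ℝ}
    (hp : IntervalIntegrable p volume a b) (hq : ContinuousOn q (Icc a b))
    (h : ∀ φ : ℝ → ℝ, ContDiff ℝ 1 φ → ∫ s in a..b, (φ s * q s + deriv φ s * p s) = 0) :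
    ∫ s in a..b, q s = 0 ∧ ∀ᵐ s ∂(volume.restrict (Icc a b)), p s = ∫ t in a..s, q t := by
  have hqi : IntervalIntegrable q volume a b := hq.intervalIntegrable_of_Icc hab.le
  have hb : ∫ s in a..b, q s = 0 := by
    simpa using h (fun _ => 1) contDiff_const
  refine ⟨hb, ?_⟩
  set P : ℝ → ℝ := fun s => ∫ t in a..s, q t with hP
  have hPd : ∀ s ∈ Icc a b, HasDerivWithinAt P (q s) (Icc a b) s :=
    fun s hs => hasDerivWithinAt_integral_Icc hq hs
  have hPc : ContinuousOn P (Icc a b) := fun s hs => (hPd s hs).continuousWithinAt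
  have hPac : AbsolutelyContinuousOnInterval P a b :=
    hqi.absolutelyContinuousOnInterval_intervalIntegral (c := a) left_mem_uIcc
  have hpP : IntegrableOn (fun s => p s - P s) (Icc a b) :=
    ((intervalIntegrable_iff_integrableOn_Icc_of_le hab.le).1 hp).sub
      (hPc.integrableOn_compact isCompact_Icc)
  have key : ∀ᵐ s ∂(volume.restrict (Icc a b)), p s - P s = 0 := by
    refine ae_eq_zero_of_integral_contDiff_smul_eq_zero
      (Integrable.locallyIntegrable hpP) fun ψ hψ _ => ?_
    have hψc : Continuous ψ := hψ.continuous
    -- test with the primitive of `ψ` and integrate by parts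
    set φ : ℝ → ℝ := fun s => ∫ t in a..s, ψ t with hφ
    have hφd : ∀ s, HasDerivAt φ (ψ s) s := fun s => (hψc.integral_hasStrictDerivAt a s).hasDerivAt
    have hφ' : deriv φ = ψ := funext fun s => (hφd s).deriv
    have hφ1 : ContDiff ℝ 1 φ :=
      contDiff_one_iff_deriv.2 ⟨fun s => (hφd s).differentiableAt, by rwa [hφ']⟩
    have hφc : Continuous φ := hφ1.continuous
    have h1 := h φ hφ1
    have h2 : ∫ s in a..b, φ s * q s = ∫ s in a..b, φ s * deriv P s := by
      rw [intervalIntegral.integral_of_le hab.le, intervalIntegral.integral_of_le hab.le,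
        ← integral_Icc_eq_integral_Ioc, ← integral_Icc_eq_integral_Ioc]
      refine integral_congr_ae ?_
      filter_upwards [ae_mem_Icc, ae_Icc_mem_nhds] with s hs hn
      rw [((hPd s hs).hasDerivAt hn).deriv]
    rw [hφ1.contDiffOn.absolutelyContinuousOnInterval.integral_mul_deriv_eq_deriv_mul hPac,
      hφ', show φ a = 0 from intervalIntegral.integral_same, show P b = 0 from hb] at h2
    have h3 : IntervalIntegrable (fun s => ψ s * p s) volume a b :=
      hp.continuousOn_mul hψc.continuousOn
    have h4 : IntervalIntegrable (fun s => ψ s * P s) volume a b :=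
      (hψc.continuousOn.mul hPc).intervalIntegrable_of_Icc hab.le
    have h5 : IntervalIntegrable (fun s => φ s * q s) volume a b :=
      (hφc.continuousOn.mul hq).intervalIntegrable_of_Icc hab.le
    rw [hφ', intervalIntegral.integral_add h5 h3, h2] at h1
    rw [integral_Icc_eq_integral_Ioc, ← intervalIntegral.integral_of_le hab.le]
    simp only [smul_eq_mul, mul_sub]
    rw [intervalIntegral.integral_sub h3 h4]
    linarith
  filter_upwards [key] with s hs using sub_eq_zero.1 hs

lemma innerO_eq_sum (X Y : Matrix (Fin n) (Fin n) ℝ) :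
    innerO X Y = ∑ i, ∑ j, X i j * Y i j := by
  simp only [innerO, Matrix.trace, Matrix.diag, Matrix.mul_apply, Matrix.transpose_apply]
  exact Finset.sum_comm

lemma memLp_bodyVel {a b : ℝ} (hab : a < b) {g : ℝ → Matrix (Fin n) (Fin n) ℝ}
    (hg : g ∈ H1 a b n) (i j : Fin n) :
    MemLp (fun s => bodyVel a b g s i j) 2 (volume.restrict (Icc a b)) := by
  have h := (mem_H1_iff hab).1 hg
  have hc := continuousOn_of_mem_H1 hab hg
  have hsum : MemLp (fun s => ∑ l, g s l i * deriv (fun s => g s l j) s) 2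
      (volume.restrict (Icc a b)) := by
    refine memLp_finsetSum _ fun l _ => memLp_continuousOn_mul ?_ (h.2 l j).memLp
    exact (continuous_id.matrix_elem l i).comp_continuousOn hc
  refine hsum.ae_eq ?_
  filter_upwards [ae_mem_Icc, ae_hasDerivAt_matrix hab fun i j => (h.2 i j).ac] with s hs hd
  simp only [bodyVel, inv_eq_transpose (h.1 s hs), Matrix.mul_apply, Matrix.transpose_apply, hd.2]

lemma intervalIntegrable_innerO_bodyVel_const {a b : ℝ} (hab : a < b)
    {g : ℝ → Matrix (Fin n) (Fin n) ℝ} (hg : g ∈ H1 a b n) (σ : Matrix (Fin n) (Fin n) ℝ) :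
    IntervalIntegrable (fun s => innerO (bodyVel a b g s) σ) volume a b := by
  rw [intervalIntegrable_iff_integrableOn_Icc_of_le hab.le]
  simp only [innerO_eq_sum]
  exact integrable_finsetSum _ fun i _ => integrable_finsetSum _ fun j _ =>
    ((memLp_bodyVel hab hg i j).integrable one_le_two).mul_const _

lemma continuousOn_clm_apply_matrix {t : Set (ℝ × Matrix (Fin n) (Fin n) ℝ)}
    {D : ℝ × Matrix (Fin n) (Fin n) ℝ → (Matrix (Fin n) (Fin n) ℝ →L[ℝ] ℝ)}
    {X : ℝ × Matrix (Fin n) (Fin n) ℝ → Matrix (Fin n) (Fin n) ℝ}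
    (hD : ContinuousOn D t) (hX : ContinuousOn X t) : ContinuousOn (fun x => D x (X x)) t :=
  hD.clm_apply hX

lemma hasDerivAt_variation (g : ℝ → Matrix (Fin n) (Fin n) ℝ) (σ : Matrix (Fin n) (Fin n) ℝ)
    (φ : ℝ → ℝ) (s ε : ℝ) :
    HasDerivAt (fun ε => variation g σ φ ε s) (φ s • (variation g σ φ ε s * σ)) ε := by
  have h1 : HasDerivAt (fun ε => NormedSpace.exp ((ε * φ s) • σ))
      (φ s • (NormedSpace.exp ((ε * φ s) • σ) * σ)) ε := by
    have := (hasDerivAt_exp_smul σ (ε * φ s)).scomp (h := fun ε => ε * φ s) ε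
      ((hasDerivAt_id ε).mul_const (φ s))
    simpa using! this
  have h2 := hasDerivWithinAt_matrix_mul
    (hasDerivWithinAt_const ε univ (g s)) h1.hasDerivWithinAt
  refine (h2.hasDerivAt univ_mem).congr_deriv ?_
  rw [Matrix.zero_mul, zero_add, Matrix.mul_smul, ← Matrix.mul_assoc]
  rfl

/-- The vanishing of the first variation at a minimizer, for variations with values in a fixed line
of the Lie algebra. -/
lemma integral_firstVariation_eq_zero {a b : ℝ} (hab : a < b)
    {U : ℝ × Matrix (Fin n) (Fin n) ℝ → ℝ}
    {D₂U : ℝ × Matrix (Fin n) (Fin n) ℝ → (Matrix (Fin n) (Fin n) ℝ →L[ℝ] ℝ)}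
    (hU : ContinuousOn U (Icc a b ×ˢ (Matrix.orthogonalGroup (Fin n) ℝ : Set _)))
    (hD : ContinuousOn D₂U (Icc a b ×ˢ (Matrix.orthogonalGroup (Fin n) ℝ : Set _)))
    (hUD : ∀ s ∈ Icc a b, ∀ h ∈ Matrix.orthogonalGroup (Fin n) ℝ,
      HasFDerivWithinAt (fun x => U (s, x)) (D₂U (s, h))
        (Matrix.orthogonalGroup (Fin n) ℝ : Set _) h)
    {g : ℝ → Matrix (Fin n) (Fin n) ℝ} (hg : g ∈ H1 a b n)
    (hmin : IsMinOn (potEnergy a b U) (H1 a b n) g)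
    {σ : Matrix (Fin n) (Fin n) ℝ} (hσ : σᵀ = -σ) {φ : ℝ → ℝ} (hφ : ContDiff ℝ 1 φ) :
    ∫ s in a..b, (φ s * D₂U (s, g s) (g s * σ) + deriv φ s * innerO (bodyVel a b g s) σ) = 0 := by
  set W : ℝ × Matrix (Fin n) (Fin n) ℝ → ℝ := fun x => D₂U x (φ x.1 • (x.2 * σ)) with hW
  have hφc := hφ.continuous
  have hφ'c := hφ.continuous_deriv le_rfl
  have hWc : ContinuousOn W (Icc a b ×ˢ (Matrix.orthogonalGroup (Fin n) ℝ : Set _)) :=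
    continuousOn_clm_apply_matrix hD (by fun_prop)
  obtain ⟨B, hB⟩ := (isCompact_Icc.prod isCompact_orthogonalGroup).exists_bound_of_continuousOn hWc
  have hvO : ∀ ε, ∀ s ∈ Icc a b, variation g σ φ ε s ∈ Matrix.orthogonalGroup (Fin n) ℝ :=
    fun ε => (variation_mem_H1 hab hg hσ hφ ε).1
  have hv0 : ∀ s, variation g σ φ 0 s = g s := fun s => by simp [variation]
  -- the potential part of the energy
  have hpot := intervalIntegral.hasDerivAt_integral_of_dominated_loc_of_deriv_le
    (μ := volume) (a := a) (b := b)
    (F := fun ε s => U (s, variation g σ φ ε s)) (F' := fun ε s => W (s, variation g σ φ ε s))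
    (x₀ := (0 : ℝ)) (s := univ) (bound := fun _ => B) univ_mem
    (Eventually.of_forall fun ε => (IntervalIntegrable.def'
      (intervalIntegrable_potential hab hU (continuousOn_of_mem_H1 hab
        (variation_mem_H1 hab hg hσ hφ ε)) (hvO ε))).aestronglyMeasurable)
    (intervalIntegrable_potential hab hU (continuousOn_of_mem_H1 hab
      (variation_mem_H1 hab hg hσ hφ 0)) (hvO 0))
    (IntervalIntegrable.def' (intervalIntegrable_potential hab hWc (continuousOn_of_mem_H1 hab
      (variation_mem_H1 hab hg hσ hφ 0)) (hvO 0))).aestronglyMeasurable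
    (ae_of_all _ fun s hs ε _ => by
      rw [uIoc_of_le hab.le] at hs
      exact hB _ ⟨Ioc_subset_Icc_self hs, hvO ε s (Ioc_subset_Icc_self hs)⟩)
    intervalIntegrable_const
    (ae_of_all _ fun s hs ε _ => by
      rw [uIoc_of_le hab.le] at hs
      have hs' := Ioc_subset_Icc_self hs
      exact (hUD s hs' _ (hvO ε s hs')).comp_hasDerivAt (f := fun ε => variation g σ φ ε s) ε
        (hasDerivAt_variation g σ φ s ε) (Eventually.of_forall fun ε => hvO ε s hs'))
  -- the kinetic part of the energy
  set p : ℝ → ℝ := fun s => innerO (bodyVel a b g s) σ with hp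
  have hpi : IntervalIntegrable p volume a b := intervalIntegrable_innerO_bodyVel_const hab hg σ
  have hA : IntervalIntegrable (fun s => deriv φ s * p s) volume a b :=
    hpi.continuousOn_mul hφ'c.continuousOn
  have hQ : IntervalIntegrable (fun s => deriv φ s ^ 2 * innerO σ σ) volume a b :=
    ((hφ'c.pow 2).mul continuous_const).intervalIntegrable _ _
  have hK := intervalIntegrable_innerO_bodyVel hab hg
  have hkin : ∀ ε, potEnergy a b U (variation g σ φ ε) =
      (∫ s in a..b, U (s, variation g σ φ ε s)) +
        (1 / 2 * (∫ s in a..b, innerO (bodyVel a b g s) (bodyVel a b g s)) +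
          ε * (∫ s in a..b, deriv φ s * p s) +
          ε ^ 2 * (1 / 2 * ∫ s in a..b, deriv φ s ^ 2 * innerO σ σ)) := by
    intro ε
    rw [potEnergy_eq hab hU (variation_mem_H1 hab hg hσ hφ ε)]
    congr 1
    have hae : (fun s => innerO (bodyVel a b (variation g σ φ ε) s)
        (bodyVel a b (variation g σ φ ε) s)) =ᵐ[volume.restrict (Icc a b)] fun s =>
        innerO (bodyVel a b g s) (bodyVel a b g s) + 2 * ε * (deriv φ s * p s) +
          ε ^ 2 * (deriv φ s ^ 2 * innerO σ σ) := by
      filter_upwards [ae_mem_Icc, ae_hasDerivAt_matrix hab fun i j =>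
        (((mem_H1_iff hab).1 hg).2 i j).ac] with s hs hd
      rw [innerO_bodyVel_variation hab hs (hg.1 s hs) hd.1.hasDerivWithinAt hσ
        (hφ.differentiable one_ne_zero s).hasDerivAt ε]
      simp only [hp]
      ring
    rw [integral_congr_ae hae, integral_Icc_eq_integral_Ioc,
      ← intervalIntegral.integral_of_le hab.le,
      intervalIntegral.integral_add (hK.add (hA.const_mul _)) (hQ.const_mul _),
      intervalIntegral.integral_add hK (hA.const_mul _),
      intervalIntegral.integral_const_mul, intervalIntegral.integral_const_mul]
    ring
  have hder : HasDerivAt (fun ε => potEnergy a b U (variation g σ φ ε))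
      ((∫ s in a..b, W (s, variation g σ φ 0 s)) + ∫ s in a..b, deriv φ s * p s) 0 := by
    have h1 := (((hasDerivAt_id (0 : ℝ)).mul_const (∫ s in a..b, deriv φ s * p s)).const_add
      (1 / 2 * (∫ s in a..b, innerO (bodyVel a b g s) (bodyVel a b g s)))).add
      (((hasDerivAt_id (0 : ℝ)).pow 2).mul_const (1 / 2 * ∫ s in a..b, deriv φ s ^ 2 * innerO σ σ))
    refine ((hpot.2.add h1).congr_deriv ?_).congr_of_eventuallyEq
      (Eventually.of_forall fun ε => hkin ε)
    simp
  have hloc : IsLocalMin (fun ε => potEnergy a b U (variation g σ φ ε)) 0 := by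
    refine Eventually.of_forall fun ε => ?_
    simp only [show variation g σ φ 0 = g from funext hv0]
    exact isMinOn_iff.1 hmin _ (variation_mem_H1 hab hg hσ hφ ε)
  have hzero := hloc.hasDerivAt_eq_zero hder
  have hWi := hpot.1
  rw [← intervalIntegral.integral_add hWi hA] at hzero
  simpa only [hv0, hW, map_smul, smul_eq_mul] using hzero

/-! ### Regularity of minimizers -/

lemma contDiffOn_succ_of_hasDerivWithinAt {a b : ℝ} (hab : a < b) {f f' : ℝ → ℝ} (r : ℕ)
    (hf : ∀ s ∈ Icc a b, HasDerivWithinAt f (f' s) (Icc a b) s)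
    (hf' : ContDiffOn ℝ r f' (Icc a b)) : ContDiffOn ℝ (r + 1) f (Icc a b) := by
  refine (contDiffOn_succ_iff_derivWithin (uniqueDiffOn_Icc hab)).2
    ⟨fun s hs => (hf s hs).differentiableWithinAt, fun h => by simp at h, ?_⟩
  exact hf'.congr fun s hs => (hf s hs).derivWithin (uniqueDiffOn_Icc hab s hs)

/-- The elementary antisymmetric matrix `E_ij - E_ji`; these span `𝔬(n)`. -/
def skewUnit (i j : Fin n) : Matrix (Fin n) (Fin n) ℝ :=
  Matrix.single i j 1 - Matrix.single j i 1

lemma transpose_skewUnit (i j : Fin n) : (skewUnit i j)ᵀ = -skewUnit i j := by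
  simp [skewUnit]

lemma skewUnit_swap (i j : Fin n) : skewUnit j i = -skewUnit i j := (neg_sub _ _).symm

lemma innerO_skewUnit (X : Matrix (Fin n) (Fin n) ℝ) (i j : Fin n) :
    innerO X (skewUnit i j) = X i j - X j i := by
  simp [innerO, skewUnit, Matrix.mul_sub, Matrix.trace_sub, Matrix.trace_mul_single]

lemma sum_smul_skewUnit {σ : Matrix (Fin n) (Fin n) ℝ} (hσ : σᵀ = -σ) :
    ∑ i, ∑ j, (1 / 2 * σ i j) • skewUnit i j = σ := by
  have h1 : ∑ i, ∑ j, σ i j • (Matrix.single i j 1 : Matrix (Fin n) (Fin n) ℝ) = σ := by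
    conv_rhs => rw [Matrix.matrix_eq_sum_single σ]
    simp
  have h2 : ∑ i, ∑ j, σ i j • (Matrix.single j i 1 : Matrix (Fin n) (Fin n) ℝ) = -σ := by
    rw [Finset.sum_comm, ← hσ]
    conv_rhs => rw [Matrix.matrix_eq_sum_single σᵀ]
    simp
  have h3 : ∀ i j, (1 / 2 * σ i j) • skewUnit i j =
      (1 / 2 : ℝ) • (σ i j • (Matrix.single i j 1 : Matrix (Fin n) (Fin n) ℝ)) -
      (1 / 2 : ℝ) • (σ i j • (Matrix.single j i 1 : Matrix (Fin n) (Fin n) ℝ)) := by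
    intro i j
    rw [skewUnit, smul_sub, mul_smul, mul_smul]
  simp only [h3, Finset.sum_sub_distrib, ← Finset.smul_sum, h1, h2]
  rw [smul_neg, sub_neg_eq_add, ← add_smul]
  norm_num

/-- A linear functional `D` on antisymmetric matrices is represented by the matrix with entries
`½ D (E_ij - E_ji)`. -/
lemma innerO_representative (D : Matrix (Fin n) (Fin n) ℝ →ₗ[ℝ] ℝ)
    {σ : Matrix (Fin n) (Fin n) ℝ} (hσ : σᵀ = -σ) :
    innerO (Matrix.of fun i j => 1 / 2 * D (skewUnit i j)) σ = D σ := by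
  conv_rhs => rw [← sum_smul_skewUnit hσ]
  simp only [innerO_eq_sum, map_sum, map_smul, smul_eq_mul, Matrix.of_apply]
  exact Finset.sum_congr rfl fun i _ => Finset.sum_congr rfl fun j _ => by ring

/-- Minimizers are regular: the weak Euler–Lagrange equation shows that the body velocity agrees
almost everywhere with a `C¹` function, and `g' = g Ω` then propagates this regularity to `g`. -/
theorem contDiffOn_and_isSolution_of_isMinOn {a b : ℝ} (hab : a < b)
    {U : ℝ × Matrix (Fin n) (Fin n) ℝ → ℝ}
    {D₂U : ℝ × Matrix (Fin n) (Fin n) ℝ → (Matrix (Fin n) (Fin n) ℝ →L[ℝ] ℝ)}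
    (hU : ContinuousOn U (Icc a b ×ˢ (Matrix.orthogonalGroup (Fin n) ℝ : Set _)))
    (hD : ContinuousOn D₂U (Icc a b ×ˢ (Matrix.orthogonalGroup (Fin n) ℝ : Set _)))
    (hUD : ∀ s ∈ Icc a b, ∀ h ∈ Matrix.orthogonalGroup (Fin n) ℝ,
      HasFDerivWithinAt (fun x => U (s, x)) (D₂U (s, h))
        (Matrix.orthogonalGroup (Fin n) ℝ : Set _) h)
    {g : ℝ → Matrix (Fin n) (Fin n) ℝ} (hg : g ∈ H1 a b n)
    (hmin : IsMinOn (potEnergy a b U) (H1 a b n) g) :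
    ContDiffOn ℝ 2 g (Icc a b) ∧
      IsSolution a b (fun s => leftTranslate (D₂U (s, g s)) (g s)) g := by
  have hO := hg.1
  have hS := ((mem_H1_iff hab).1 hg).2
  have hgc := continuousOn_of_mem_H1 hab hg
  set q : Fin n → Fin n → ℝ → ℝ := fun i j s => D₂U (s, g s) (g s * skewUnit i j) with hq
  have hqc : ∀ i j, ContinuousOn (q i j) (Icc a b) := fun i j =>
    continuousOn_comp_curve (U := fun x => D₂U x (x.2 * skewUnit i j))
      (continuousOn_clm_apply_matrix hD (by fun_prop)) hgc hO
  have hdBR := fun i j => ae_eq_integral_of_forall_integral_eq_zero hab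
    (intervalIntegrable_innerO_bodyVel_const hab hg (skewUnit i j)) (hqc i j)
    (fun φ hφ => integral_firstVariation_eq_zero hab hU hD hUD hg hmin
      (transpose_skewUnit i j) hφ)
  -- the continuous representative of the body velocity
  set Ω : ℝ → Matrix (Fin n) (Fin n) ℝ := fun s =>
    Matrix.of fun i j => 1 / 2 * ∫ t in a..s, q i j t with hΩ
  have hΩd : ∀ i j, ∀ s ∈ Icc a b,
      HasDerivWithinAt (fun s => Ω s i j) (1 / 2 * q i j s) (Icc a b) s := fun i j s hs =>
    (hasDerivWithinAt_integral_Icc (hqc i j) hs).const_mul _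
  have hΩ1 : ∀ i j, ContDiffOn ℝ 1 (fun s => Ω s i j) (Icc a b) := fun i j => by
    simpa using contDiffOn_succ_of_hasDerivWithinAt hab 0 (hΩd i j)
      (by
      rw [Nat.cast_zero, contDiffOn_zero]
      exact continuousOn_const.mul (hqc i j))
  have hΩae : ∀ᵐ s ∂(volume.restrict (Icc a b)), bodyVel a b g s = Ω s := by
    have hall : ∀ᵐ s ∂(volume.restrict (Icc a b)), ∀ i j,
        innerO (bodyVel a b g s) (skewUnit i j) = ∫ t in a..s, q i j t := by
      rw [ae_all_iff]; intro i
      rw [ae_all_iff]; intro j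
      exact (hdBR i j).2
    filter_upwards [hall, ae_mem_Icc, ae_hasDerivAt_matrix hab fun i j => (hS i j).ac]
      with s h1 hs hd
    have hskew := transpose_bodyVel hab hs hO hd.1.hasDerivWithinAt
    ext i j
    have h2 := h1 i j
    have h3 : bodyVel a b g s j i = -bodyVel a b g s i j := congrFun (congrFun hskew i) j
    rw [innerO_skewUnit, h3] at h2
    simp only [hΩ, Matrix.of_apply, ← h2]
    ring
  -- the derivative of `g` agrees almost everywhere with the continuous function `g Ω`
  have hgΩc : ∀ i j, ContinuousOn (fun s => (g s * Ω s) i j) (Icc a b) := by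
    intro i j
    simp only [Matrix.mul_apply]
    exact continuousOn_finsetSum _ fun l _ =>
      ((continuous_id.matrix_elem i l).comp_continuousOn hgc).mul (hΩ1 l j).continuousOn
  have hgd : ∀ i j, ∀ s ∈ Icc a b,
      HasDerivWithinAt (fun s => g s i j) ((g s * Ω s) i j) (Icc a b) s := by
    intro i j
    have hint : ∀ s ∈ Icc a b, g s i j = g a i j + ∫ t in a..s, (g t * Ω t) i j := by
      intro s hs
      have h1 := ((hS i j).ac.mono (c := a) (d := s) (by
        rw [uIcc_of_le hab.le, uIcc_of_le hs.1]
        exact Icc_subset_Icc le_rfl hs.2)).integral_deriv_eq_sub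
      have h2 : ∫ t in a..s, deriv (fun s => g s i j) t = ∫ t in a..s, (g t * Ω t) i j := by
        rw [intervalIntegral.integral_of_le hs.1, intervalIntegral.integral_of_le hs.1]
        refine integral_congr_ae (ae_restrict_of_ae_restrict_of_subset
          (Ioc_subset_Icc_self.trans (Icc_subset_Icc le_rfl hs.2)) ?_)
        filter_upwards [hΩae, ae_mem_Icc, ae_hasDerivAt_matrix hab fun i j => (hS i j).ac]
          with t h3 ht hd
        rw [← hd.2 i j, ← h3, bodyVel, inv_eq_transpose (hO t ht), ← Matrix.mul_assoc,
          mul_transpose_of_mem (hO t ht), Matrix.one_mul]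
      rw [← h2, h1]
      ring
    intro s hs
    exact ((hasDerivWithinAt_integral_Icc (hgΩc i j) hs).const_add (g a i j)).congr hint
      (hint s hs)
  have hg1 : ∀ i j, ContDiffOn ℝ 1 (fun s => g s i j) (Icc a b) := fun i j => by
    simpa using contDiffOn_succ_of_hasDerivWithinAt hab 0 (hgd i j) (by simpa using hgΩc i j)
  have hg2 : ∀ i j, ContDiffOn ℝ 2 (fun s => g s i j) (Icc a b) := fun i j => by
    have h : ContDiffOn ℝ 1 (fun s => (g s * Ω s) i j) (Icc a b) := by
      simp only [Matrix.mul_apply]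
      exact ContDiffOn.sum fun l _ => (hg1 i l).mul (hΩ1 l j)
    have := contDiffOn_succ_of_hasDerivWithinAt hab 1 (hgd i j) (by simpa using h)
    simpa [one_add_one_eq_two] using this
  have hgd' : ∀ s ∈ Icc a b, HasDerivWithinAt g (g s * Ω s) (Icc a b) s :=
    fun s hs => hasDerivWithinAt_matrix.2 fun i j => hgd i j s hs
  have hbody : ∀ s ∈ Icc a b, bodyVel a b g s = Ω s := fun s hs => by
    rw [bodyVel_of_hasDerivWithinAt hab hs (hO s hs) (hgd' s hs), ← Matrix.mul_assoc,
      mem_orthogonalGroup_iff_transpose.1 (hO s hs), Matrix.one_mul]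
  refine ⟨contDiffOn_matrix.2 hg2, fun s hs => (hgd' s hs).differentiableWithinAt, ?_, ?_, ?_⟩
  · intro s hs
    refine ⟨⟨Matrix.of fun i j => 1 / 2 * q i j s, ?_⟩, ?_, ?_⟩
    · rw [LieAlgebra.Orthogonal.mem_so]
      ext i j
      simp only [Matrix.transpose_apply, Matrix.of_apply, Matrix.neg_apply, hq]
      rw [skewUnit_swap, Matrix.mul_neg, map_neg, mul_neg]
    · exact (hasDerivWithinAt_matrix.2 fun i j => hΩd i j s hs).congr hbody (hbody s hs)
    · ext σ
      have hσ := (LieAlgebra.Orthogonal.mem_so (Fin n) ℝ _).1 σ.2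
      exact innerO_representative
        ((D₂U (s, g s)).toLinearMap ∘ₗ LinearMap.mulLeft ℝ (g s)) hσ
  · rw [hbody a (left_mem_Icc.2 hab.le)]
    ext i j
    simp [hΩ]
  · rw [hbody b (right_mem_Icc.2 hab.le)]
    ext i j
    simp [hΩ, (hdBR i j).1]

/-! ### The potential of curve registration -/

lemma innerL_eq_sum (w : Fin k → ℝ) (A B : Matrix (Fin n) (Fin k) ℝ) :
    innerL w A B = ∑ i, ∑ j, w i * (A j i * B j i) := by
  rw [innerL, Matrix.mul_assoc]
  simp only [Matrix.trace, Matrix.diag, Matrix.diagonal_mul]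
  simp only [Matrix.mul_apply, Matrix.transpose_apply, Finset.mul_sum]

/-- The potential of curve registration, as a function of the two jets. -/
noncomputable def registrationPotential (w : Fin k → ℝ) (J₁ J₂ : ℝ → Matrix (Fin n) (Fin k) ℝ)
    (x : ℝ × Matrix (Fin n) (Fin n) ℝ) : ℝ :=
  1 / 2 * innerL w (x.2 * J₁ x.1 - J₂ x.1) (x.2 * J₁ x.1 - J₂ x.1)

/-- The linear functional `y ↦ ⟨A, y J⟩_L`. -/
noncomputable def innerLMul (w : Fin k → ℝ) (A J : Matrix (Fin n) (Fin k) ℝ) :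
    Matrix (Fin n) (Fin n) ℝ →L[ℝ] ℝ :=
  LinearMap.toContinuousLinearMap
    { toFun := fun y => innerL w A (y * J)
      map_add' := fun y z => by simp [innerL, Matrix.add_mul, Matrix.mul_add]
      map_smul' := fun r y => by simp [innerL] }

lemma innerLMul_apply (w : Fin k → ℝ) (A J : Matrix (Fin n) (Fin k) ℝ)
    (y : Matrix (Fin n) (Fin n) ℝ) : innerLMul w A J y = innerL w A (y * J) := rfl

/-- The derivative of the potential of curve registration with respect to the group variable. -/
noncomputable def registrationPotentialDeriv (w : Fin k → ℝ)
    (J₁ J₂ : ℝ → Matrix (Fin n) (Fin k) ℝ) (x : ℝ × Matrix (Fin n) (Fin n) ℝ) :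
    Matrix (Fin n) (Fin n) ℝ →L[ℝ] ℝ :=
  innerLMul w (x.2 * J₁ x.1 - J₂ x.1) (J₁ x.1)

lemma continuousOn_innerL {X : Type*} [TopologicalSpace X] {t : Set X} (w : Fin k → ℝ)
    {A B : X → Matrix (Fin n) (Fin k) ℝ} (hA : ContinuousOn A t) (hB : ContinuousOn B t) :
    ContinuousOn (fun x => innerL w (A x) (B x)) t := by
  simp only [innerL_eq_sum]
  exact continuousOn_finsetSum _ fun i _ => continuousOn_finsetSum _ fun j _ =>
    continuousOn_const.mul (((continuous_id.matrix_elem j i).comp_continuousOn hA).mul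
      ((continuous_id.matrix_elem j i).comp_continuousOn hB))

lemma continuousOn_jet {a b : ℝ} (hab : a < b) {c : ℝ → EuclideanSpace ℝ (Fin n)}
    (hc : ContDiffOn ℝ k c (Icc a b)) : ContinuousOn (jet a b k c) (Icc a b) := by
  refine continuousOn_pi.2 fun j => continuousOn_pi.2 fun i => ?_
  have h := hc.continuousOn_iteratedDerivWithin (m := (i : ℕ) + 1)
    (by exact_mod_cast Nat.succ_le_of_lt i.2) (uniqueDiffOn_Icc hab)
  exact (EuclideanSpace.proj (𝕜 := ℝ) j).continuous.comp_continuousOn h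

lemma continuousOn_mul_jet_sub {a b : ℝ} {J₁ J₂ : ℝ → Matrix (Fin n) (Fin k) ℝ}
    (h₁ : ContinuousOn J₁ (Icc a b)) (h₂ : ContinuousOn J₂ (Icc a b))
    (t : Set (Matrix (Fin n) (Fin n) ℝ)) :
    ContinuousOn (fun x : ℝ × Matrix (Fin n) (Fin n) ℝ => x.2 * J₁ x.1 - J₂ x.1)
      (Icc a b ×ˢ t) := by
  have h₁' : ContinuousOn (fun x : ℝ × Matrix (Fin n) (Fin n) ℝ => J₁ x.1) (Icc a b ×ˢ t) :=
    h₁.comp continuousOn_fst fun x hx => hx.1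
  have h₂' : ContinuousOn (fun x : ℝ × Matrix (Fin n) (Fin n) ℝ => J₂ x.1) (Icc a b ×ˢ t) :=
    h₂.comp continuousOn_fst fun x hx => hx.1
  have hmul : Continuous fun p : Matrix (Fin n) (Fin n) ℝ × Matrix (Fin n) (Fin k) ℝ =>
      p.1 * p.2 := continuous_fst.matrix_mul continuous_snd
  exact (hmul.comp_continuousOn (continuousOn_snd.prodMk h₁')).sub h₂'

lemma continuousOn_registrationPotential {a b : ℝ} (w : Fin k → ℝ)
    {J₁ J₂ : ℝ → Matrix (Fin n) (Fin k) ℝ}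
    (h₁ : ContinuousOn J₁ (Icc a b)) (h₂ : ContinuousOn J₂ (Icc a b))
    (t : Set (Matrix (Fin n) (Fin n) ℝ)) :
    ContinuousOn (registrationPotential w J₁ J₂) (Icc a b ×ˢ t) :=
  continuousOn_const.mul (continuousOn_innerL w (continuousOn_mul_jet_sub h₁ h₂ t)
    (continuousOn_mul_jet_sub h₁ h₂ t))

lemma continuousOn_registrationPotentialDeriv {a b : ℝ} (w : Fin k → ℝ)
    {J₁ J₂ : ℝ → Matrix (Fin n) (Fin k) ℝ}
    (h₁ : ContinuousOn J₁ (Icc a b)) (h₂ : ContinuousOn J₂ (Icc a b))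
    (t : Set (Matrix (Fin n) (Fin n) ℝ)) :
    ContinuousOn (registrationPotentialDeriv w J₁ J₂) (Icc a b ×ˢ t) := by
  refine continuousOn_clm_apply.2 fun y => ?_
  have h₁' : ContinuousOn (fun x : ℝ × Matrix (Fin n) (Fin n) ℝ => J₁ x.1) (Icc a b ×ˢ t) :=
    h₁.comp continuousOn_fst fun x hx => hx.1
  have hmul : Continuous fun A : Matrix (Fin n) (Fin k) ℝ => y * A :=
    continuous_const.matrix_mul continuous_id
  exact continuousOn_innerL w (continuousOn_mul_jet_sub h₁ h₂ t) (hmul.comp_continuousOn h₁')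

lemma hasFDerivAt_registrationPotential (w : Fin k → ℝ) (J₁ J₂ : ℝ → Matrix (Fin n) (Fin k) ℝ)
    (s : ℝ) (h : Matrix (Fin n) (Fin n) ℝ) :
    HasFDerivAt (fun x => registrationPotential w J₁ J₂ (s, x))
      (registrationPotentialDeriv w J₁ J₂ (s, h)) h := by
  let ℓ : Fin n → Fin k → (Matrix (Fin n) (Fin n) ℝ →L[ℝ] ℝ) := fun j i =>
    LinearMap.toContinuousLinearMap
      { toFun := fun y => (y * J₁ s) j i
        map_add' := fun y z => by simp [Matrix.add_mul]
        map_smul' := fun r y => by simp }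
  have hd : ∀ j i, HasFDerivAt (fun x : Matrix (Fin n) (Fin n) ℝ =>
      w i * ((ℓ j i x - J₂ s j i) * (ℓ j i x - J₂ s j i))) _ h := fun j i =>
    (((ℓ j i).hasFDerivAt.sub_const (J₂ s j i)).mul
      ((ℓ j i).hasFDerivAt.sub_const (J₂ s j i))).const_mul (w i)
  have hsum := (HasFDerivAt.fun_sum (u := Finset.univ) fun i _ =>
    HasFDerivAt.fun_sum (u := Finset.univ) fun j _ => hd j i).const_mul (1 / 2)
  have hf : (fun x => registrationPotential w J₁ J₂ (s, x)) = fun x =>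
      1 / 2 * ∑ i, ∑ j, w i * ((ℓ j i x - J₂ s j i) * (ℓ j i x - J₂ s j i)) := by
    ext x
    simp only [registrationPotential, innerL_eq_sum]
    rfl
  rw [hf]
  refine hsum.congr_fderiv ?_
  refine ContinuousLinearMap.ext fun y => ?_
  have hy : registrationPotentialDeriv w J₁ J₂ (s, h) y =
      ∑ i, ∑ j, w i * ((ℓ j i h - J₂ s j i) * ℓ j i y) := by
    rw [registrationPotentialDeriv, innerLMul_apply, innerL_eq_sum]
    rfl
  refine Eq.trans ?_ hy.symm
  simp only [smul_apply, sum_apply, add_apply, smul_eq_mul, Finset.mul_sum]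
  refine Finset.sum_congr rfl fun i _ => Finset.sum_congr rfl fun j _ => ?_
  change 1 / 2 * (w i * ((ℓ j i h - J₂ s j i) * ℓ j i y + (ℓ j i h - J₂ s j i) * ℓ j i y)) = _
  ring

lemma energy_eq_potEnergy (a b : ℝ) (w : Fin k → ℝ) (c₁ c₂ : ℝ → EuclideanSpace ℝ (Fin n)) :
    energy a b w c₁ c₂ =
      potEnergy a b (registrationPotential w (jet a b k c₁) (jet a b k c₂)) := by
  ext g
  rw [energy, potEnergy, ← intervalIntegral.integral_const_mul]
  congr 1
  ext s
  simp only [energyDensity, potEnergyDensity, registrationPotential]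
  ring

lemma innerL_self_skew (w : Fin k → ℝ) (A : Matrix (Fin n) (Fin k) ℝ)
    {σ : Matrix (Fin n) (Fin n) ℝ} (hσ : σᵀ = -σ) : innerL w A (σ * A) = 0 := by
  have h : innerL w A (σ * A) = -innerL w A (σ * A) := by
    conv_lhs => rw [innerL, ← Matrix.trace_transpose]
    simp only [Matrix.transpose_mul, Matrix.transpose_transpose, Matrix.diagonal_transpose, hσ,
      innerL]
    rw [← Matrix.mul_assoc, Matrix.trace_mul_comm]
    simp [Matrix.mul_assoc]
  linarith

/-- The derivative of the registration potential along `g 𝔬(n)` is the diamond term: the part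
that is quadratic in the first jet vanishes by antisymmetry. -/
lemma leftTranslate_registrationPotentialDeriv (w : Fin k → ℝ)
    (J₁ J₂ : ℝ → Matrix (Fin n) (Fin k) ℝ) (s : ℝ) {h : Matrix (Fin n) (Fin n) ℝ}
    (hh : h ∈ Matrix.orthogonalGroup (Fin n) ℝ) :
    leftTranslate (registrationPotentialDeriv w J₁ J₂ (s, h)) h =
      diamond (h⁻¹ * J₂ s) (flat w (J₁ s)) := by
  ext σ
  have hσ := (LieAlgebra.Orthogonal.mem_so (Fin n) ℝ _).1 σ.2
  change innerL w (h * J₁ s - J₂ s) (h * (σ : Matrix (Fin n) (Fin n) ℝ) * J₁ s) =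
    innerL w (J₁ s) ((σ : Matrix (Fin n) (Fin n) ℝ) * (h⁻¹ * J₂ s))
  generalize (σ : Matrix (Fin n) (Fin n) ℝ) = τ at hσ
  have h1 : innerL w (h * J₁ s - J₂ s) (h * τ * J₁ s) =
      innerL w (J₁ s) (τ * J₁ s) - innerL w (J₂ s) (h * τ * J₁ s) := by
    simp only [innerL, Matrix.transpose_sub, Matrix.mul_sub, Matrix.sub_mul, Matrix.trace_sub,
      Matrix.transpose_mul]
    congr 2
    simp only [Matrix.mul_assoc]
    rw [← Matrix.mul_assoc hᵀ, mem_orthogonalGroup_iff_transpose.1 hh, Matrix.one_mul]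
  have h2 : innerL w (J₁ s) (τ * (h⁻¹ * J₂ s)) = -innerL w (J₂ s) (h * τ * J₁ s) := by
    rw [inv_eq_transpose hh]
    conv_lhs => rw [innerL, ← Matrix.trace_transpose]
    simp only [Matrix.transpose_mul, Matrix.transpose_transpose, Matrix.diagonal_transpose, hσ,
      innerL]
    rw [← Matrix.mul_assoc, Matrix.trace_mul_comm]
    simp [Matrix.mul_assoc]
  rw [h1, h2, innerL_self_skew w _ hσ, zero_sub]

end CurveRegistration

theorem mainTheorem2 (a b : ℝ) (hab : a < b) (n : ℕ) :
    -- the curve registration energy of two `C^k` curves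
    (∀ (k : ℕ) (w : Fin k → ℝ), (∀ i, 0 < w i) →
      ∀ c₁ c₂ : ℝ → EuclideanSpace ℝ (Fin n),
        ContDiffOn ℝ k c₁ (Set.Icc a b) → ContDiffOn ℝ k c₂ (Set.Icc a b) →
        (∀ g ∈ CurveRegistration.H1 a b n,
          IntervalIntegrable (CurveRegistration.energyDensity a b w c₁ c₂ g)
            MeasureTheory.volume a b) ∧
        (∃ g ∈ CurveRegistration.H1 a b n,
          IsMinOn (CurveRegistration.energy a b w c₁ c₂) (CurveRegistration.H1 a b n) g) ∧
        (∀ g ∈ CurveRegistration.H1 a b n,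
          IsMinOn (CurveRegistration.energy a b w c₁ c₂) (CurveRegistration.H1 a b n) g →
          ContDiffOn ℝ 2 g (Set.Icc a b) ∧
          CurveRegistration.IsSolution a b
            (fun s => CurveRegistration.diamond ((g s)⁻¹ * CurveRegistration.jet a b k c₂ s)
              (CurveRegistration.flat w (CurveRegistration.jet a b k c₁ s))) g)) ∧
    -- the energy with a general potential `U` that is continuous on `[a, b] × O(n)` and has a
    -- continuous derivative `D₂U`
    (∀ (U : ℝ × Matrix (Fin n) (Fin n) ℝ → ℝ)
        (D₂U : ℝ × Matrix (Fin n) (Fin n) ℝ → (Matrix (Fin n) (Fin n) ℝ →L[ℝ] ℝ)),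
        ContinuousOn U (Set.Icc a b ×ˢ (Matrix.orthogonalGroup (Fin n) ℝ : Set _)) →
        ContinuousOn D₂U (Set.Icc a b ×ˢ (Matrix.orthogonalGroup (Fin n) ℝ : Set _)) →
        (∀ s ∈ Set.Icc a b, ∀ h ∈ Matrix.orthogonalGroup (Fin n) ℝ,
          HasFDerivWithinAt (fun x => U (s, x)) (D₂U (s, h))
            (Matrix.orthogonalGroup (Fin n) ℝ : Set _) h) →
        (∀ g ∈ CurveRegistration.H1 a b n,
          IntervalIntegrable (CurveRegistration.potEnergyDensity a b U g)
            MeasureTheory.volume a b) ∧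
        (∃ g ∈ CurveRegistration.H1 a b n,
          IsMinOn (CurveRegistration.potEnergy a b U) (CurveRegistration.H1 a b n) g) ∧
        (∀ g ∈ CurveRegistration.H1 a b n,
          IsMinOn (CurveRegistration.potEnergy a b U) (CurveRegistration.H1 a b n) g →
          ContDiffOn ℝ 2 g (Set.Icc a b) ∧
          CurveRegistration.IsSolution a b
            (fun s => CurveRegistration.leftTranslate (D₂U (s, g s)) (g s)) g)) := by
  refine ⟨fun k w _ c₁ c₂ hc₁ hc₂ => ?_, fun U D₂U hU hD hUD =>
    ⟨fun g hg => CurveRegistration.intervalIntegrable_potEnergyDensity hab hU hg,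
      CurveRegistration.exists_isMinOn_potEnergy hab hU, fun g hg hmin =>
      CurveRegistration.contDiffOn_and_isSolution_of_isMinOn hab hU hD hUD hg hmin⟩⟩
  have h₁ := CurveRegistration.continuousOn_jet hab hc₁
  have h₂ := CurveRegistration.continuousOn_jet hab hc₂
  have hU := CurveRegistration.continuousOn_registrationPotential w h₁ h₂
    (Matrix.orthogonalGroup (Fin n) ℝ)
  rw [CurveRegistration.energy_eq_potEnergy]
  refine ⟨fun g hg => ?_, CurveRegistration.exists_isMinOn_potEnergy hab hU, fun g hg hmin => ?_⟩
  · refine ((CurveRegistration.intervalIntegrable_potEnergyDensity hab hU hg).const_mul 2).congr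
      fun s _ => ?_
    simp only [CurveRegistration.energyDensity, CurveRegistration.potEnergyDensity,
      CurveRegistration.registrationPotential]
    ring
  · obtain ⟨hC, hsol⟩ := CurveRegistration.contDiffOn_and_isSolution_of_isMinOn hab hU
      (CurveRegistration.continuousOn_registrationPotentialDeriv w h₁ h₂ _)
      (fun s _ h _ =>
        (CurveRegistration.hasFDerivAt_registrationPotential w _ _ s h).hasFDerivWithinAt) hg hmin
    refine ⟨hC, hsol.differentiableOn, fun s hs => ?_, hsol.left_boundary, hsol.right_boundary⟩
    obtain ⟨Ω', hΩ', he⟩ := hsol.equation s hs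
    exact ⟨Ω', hΩ', he.trans
      (CurveRegistration.leftTranslate_registrationPotentialDeriv w _ _ s (hg.1 s hs))⟩
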